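/- **Setting.** Let $\mu$ be a Borel measure on $\mathbb{R}$, $A(\theta)=\ln\int e^{\theta x}\,d\mu(x)$, $\Phi=\Phi_\mu=\{\theta\in\mathbb{R} : A(\theta)<\infty\}$, and for $\theta\in\Phi$ let $P_\theta$ be the distribution with density $e^{\theta x-A(\theta)}$ relative to $\mu$. Put $\mathcal{P}_\mu=\{P_\theta:\theta\in\Phi\}$ and, for $\theta\in\Phi$ and $\beta\ge 0$, $$J^{-1}_{\mathrm{TV},\theta}(\beta)=\sup\{|h| : \theta+h\in\Phi,\ \mathrm{TV}(P_\theta,P_{\theta+h})\le\beta\}\in[0,\infty],$$ $$\kappa(\theta)=\sup\Big\{r\ge 0 : [\theta-r,\theta+r]\subseteq\operatorname{int}\Phi \text{ and } \tfrac{A''(\theta)}{A''(\theta')}\in[\tfrac12,2]\ \ \forall\,\theta'\in[\theta-r,\theta+r]\Big\}\in[0,\infty]$$ (with $\sup\emptyset=0$), where $\mathrm{TV}(P,Q)=\frac12\int|dP-dQ|$. For a randomised estimator $\hat\theta:\mathbb{R}^n\to\mathbb{R}$ and a distribution $P_\theta$, let $\mathcal{E}_n(\hat\theta,P_\theta)$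 be the least $\alpha$ such that $|\hat\theta(X_1,\dots,X_n)-\theta|\le\alpha$ with probability at least $0.75$ when $X_1,\dots,X_n\sim P_\theta$ are i.i.d. (the probability is over the samples and the randomness of $\hat\theta$). The estimator is $\varepsilon$-differentially private if $\Pr[\hat\theta(d)\in E]\le e^{\varepsilon}\Pr[\hat\theta(d')\in E]$ for all data sets $d,d'\in\mathbb{R}^n$ that differ in one record and all events $E$. The optimal $\varepsilon$-DP local estimation rate of the functional $P_\theta\mapsto\theta$ at $P_{\theta_0}$ is $$\mathcal{E}^{\mathrm{loc}}_{n,\varepsilon}(P_{\theta_0})=\sup_{Q\in\mathcal{P}_\mu}\ \inf_{\hat\theta\ \varepsilon\text{-DP}}\ \max\{\mathcal{E}_n(\hat\theta,P_{\theta_0}),\ \mathcal{E}_n(\hat\theta,Q)\}.$$ **Corollary (optimal local estimation rate in the high privacy regime).** For all constants $k>0$ and $\zeta>0$ there exist constants $C_1,C_2,C_3>0$, depending only on $k$ and $\zeta$, such that the following holds for every $\mu$, every $\theta_0\in\Phi$, every sequence $(\varepsilon_n)$ and every $n\ge1$. If * $0<\varepsilon_n\le k/\sqrt n$, * $\dfrac{\mathbb{E}_{P_{\theta_0}}(X-A'(\theta_0))^4}{A''(\theta_0)^2}\le\zeta$,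 * $\kappa(\theta_0)\ge J^{-1}_{\mathrm{TV},\theta_0}\!\Big(\dfrac{C_3}{n\varepsilon_n}\Big)$, * $\dfrac{C_3}{n\varepsilon_n}\le\dfrac{9}{128\,\zeta}$, and * $\mathrm{TV}(P_{\theta_0},P_{\theta_1})\ge\dfrac{C_3}{n\varepsilon_n}$ for some $\theta_1\in\Phi$, then $$\mathcal{E}^{\mathrm{loc}}_{n,\varepsilon_n}(P_{\theta_0})\in\left[\frac{C_1}{n\varepsilon_n\sqrt{A''(\theta_0)}},\ \frac{C_2}{n\varepsilon_n\sqrt{A''(\theta_0)}}\right].$$ -/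

import Mathlib

open MeasureTheory ProbabilityTheory
open scoped ENNReal NNReal

namespace PrivateEstimation

noncomputable section

/-! ### Randomised estimators, error rates and the optimal local estimation rate -/

/-- `ε`-differential privacy of a randomised map on data sets of size `n`: for any two data sets
that differ in one record (at most), the probabilities of every output event agree up to the
factor `e^ε`. -/
def IsDP {χ : Type*} [MeasurableSpace χ] {n : ℕ} (ε : ℝ) (M : Kernel (Fin n → χ) ℝ) : Prop :=
  ∀ x y : Fin n → χ, (∃ i, ∀ j, j ≠ i → x j = y j) →
    ∀ E : Set ℝ, MeasurableSet E → M x E ≤ ENNReal.ofReal (Real.exp ε) * M y E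

/-- The class of all `ε`-differentially private randomised estimators taking `n` samples. -/
def dpEstimators (χ : Type*) [MeasurableSpace χ] (n : ℕ) (ε : ℝ) : Set (Kernel (Fin n → χ) ℝ) :=
  {M | IsMarkovKernel M ∧ IsDP ε M}

/-- The error rate of the randomised estimator `M` when the `n` samples are i.i.d. from `P` and the
target value is `t`: the least `α` such that the output is within `α` of `t` with probability at
least `0.75` over samples and internal randomness. -/
def errorRate {χ : Type*} [MeasurableSpace χ] {n : ℕ} (M : Kernel (Fin n → χ) ℝ)
    (P : Measure χ) (t : ℝ) : ℝ≥0∞ :=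
  ⨅ (α : ℝ≥0) (_ : 3 / 4 ≤ (M ∘ₘ (Measure.pi fun _ : Fin n => P)) {y : ℝ | |y - t| ≤ α}),
    (α : ℝ≥0∞)

/-- The optimal local estimation rate at `P` of the functional `θ` over the family `Fam`, for the
class `𝓕` of estimators with `n` samples. -/
def localRate {χ : Type*} [MeasurableSpace χ] {n : ℕ} (P : Measure χ) (Fam : Set (Measure χ))
    (𝓕 : Set (Kernel (Fin n → χ) ℝ)) (θ : Measure χ → ℝ) : ℝ≥0∞ :=
  ⨆ Q ∈ Fam, ⨅ M ∈ 𝓕, max (errorRate M P (θ P)) (errorRate M Q (θ Q))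

/-- Total variation distance `(1/2) ∫ |p - q|`, with densities taken with respect to the common
dominating measure `P + Q`. -/
def tvDist {χ : Type*} [MeasurableSpace χ] (P Q : Measure χ) : ℝ :=
  (1 / 2) * ∫ x, |(P.rnDeriv (P + Q) x).toReal - (Q.rnDeriv (P + Q) x).toReal| ∂(P + Q)

/-! ### One-parameter exponential families -/

/-- The natural parameter space: all `θ` with `∫ e^{θ x} dμ(x) < ∞`. -/
def paramSpace (μ : Measure ℝ) : Set ℝ :=
  {θ | Integrable (fun x => Real.exp (θ * x)) μ}

/-- The log-normaliser `A(θ) = ln ∫ e^{θ x} dμ(x)` (meaningful for `θ` in the parameter space). -/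
def logNorm (μ : Measure ℝ) (θ : ℝ) : ℝ :=
  Real.log (∫ x, Real.exp (θ * x) ∂μ)

/-- The member `P_θ` of the family, with density `e^{θ x - A(θ)}` relative to `μ`. -/
def expMeasure (μ : Measure ℝ) (θ : ℝ) : Measure ℝ :=
  μ.withDensity fun x => ENNReal.ofReal (Real.exp (θ * x - logNorm μ θ))

/-- The family of distributions `{P_θ}`. -/
def expFamily (μ : Measure ℝ) : Set (Measure ℝ) :=
  expMeasure μ '' paramSpace μ

/-- The functional `P_θ ↦ θ` on the family. -/
def natParam (μ : Measure ℝ) : Measure ℝ → ℝ :=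
  Function.invFunOn (expMeasure μ) (paramSpace μ)

/-- `A'(θ)`, the mean of `P_θ`. -/
def logNorm' (μ : Measure ℝ) : ℝ → ℝ := deriv (logNorm μ)

/-- `A''(θ)`, the variance of `P_θ`. -/
def logNorm'' (μ : Measure ℝ) : ℝ → ℝ := deriv (deriv (logNorm μ))

/-- The radius of smoothness `κ(θ)` of `A''` around `θ`, possibly infinite: the largest `r` such
that, on all of `[θ - r, θ + r]`, `A''` exists and is within a factor `2` of `A''(θ)`. -/
def smoothRadius (μ : Measure ℝ) (θ : ℝ) : ℝ≥0∞ :=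
  ⨆ (r : ℝ≥0) (_ : ∀ θ' ∈ Set.Icc (θ - r) (θ + r), θ' ∈ interior (paramSpace μ) ∧
    logNorm'' μ θ / logNorm'' μ θ' ∈ Set.Icc (1 / 2 : ℝ) 2), (r : ℝ≥0∞)

/-- `J_{TV,θ}⁻¹(β) = sup {|h| : TV(P_θ, P_{θ+h}) ≤ β}`, where `θ + h` ranges over the parameter
space; possibly infinite. -/
def tvModulus (μ : Measure ℝ) (θ β : ℝ) : ℝ≥0∞ :=
  ⨆ (h : ℝ) (_ : θ + h ∈ paramSpace μ ∧ tvDist (expMeasure μ θ) (expMeasure μ (θ + h)) ≤ β),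
    ENNReal.ofReal |h|

end

end PrivateEstimation

/-! With `n` samples in the high privacy regime, an `ε`-DP test can tell `P` from `Q` exactly when
their total variation distance is at least of order `1 / (nε)`. Write `V = A''(θ₀)`. Near `θ₀` the
distance from `P_θ₀` to `P_θ` is comparable to `|θ - θ₀| √V`, and the rate is the quotient of these
two scales.

Lower bound: changing the law of one sample multiplies the probability of any output event by at
most `1 + TV (e^ε - 1)`. If `n TV (e^ε - 1) ≤ 1`, all `n` changes cost a factor at most `e < 3`, so
no private estimator can be right with probability `3/4` at both points
(`ofReal_half_abs_sub_le_max_errorRate`). The intermediate value theorem supplies a `θ` at the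
critical distance, and `tvDist_expMeasure_le` turns this distance into a gap `|θ - θ₀|`.

Upper bound: the estimator may depend on `Q`. If `Q` is far in total variation, a private test
recovers the parameter with error zero (`exists_dpEstimator_errorRate_eq_zero`). If it is near, a
constant estimator suffices, because `abs_sub_mul_sqrt_le_tvDist`, which rests on the fourth moment,
bounds `|θ - θ₀|`. -/

namespace PrivateEstimation

/-! ### Total variation distance -/

section TotalVariation

variable {χ : Type*} [MeasurableSpace χ]

lemma tvDist_nonneg (P Q : Measure χ) : 0 ≤ tvDist P Q := by
  unfold tvDist
  have := integral_nonneg (μ := P + Q) (f := fun x => |(P.rnDeriv (P + Q) x).toReal -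
    (Q.rnDeriv (P + Q) x).toReal|) fun _ => abs_nonneg _
  linarith

/-- As `p - q` integrates to zero, `G` may be recentred at the midpoint of `[a, b]`, where it is at
most `(b - a) / 2` in absolute value. -/
lemma integral_sub_integral_le_tvDist (P Q : Measure χ) [IsProbabilityMeasure P]
    [IsProbabilityMeasure Q] {G : χ → ℝ} (hG : Measurable G) {a b : ℝ}
    (ha : ∀ x, a ≤ G x) (hb : ∀ x, G x ≤ b) :
    ∫ x, G x ∂P - ∫ x, G x ∂Q ≤ tvDist P Q * (b - a) := by
  have hPν : P ≪ P + Q := Measure.AbsolutelyContinuous.rfl.add_right Q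
  have hQν : Q ≪ P + Q := by
    rw [add_comm]; exact Measure.AbsolutelyContinuous.rfl.add_right P
  unfold tvDist
  set ν := P + Q with hν
  set p : χ → ℝ := fun x => (P.rnDeriv ν x).toReal with hp
  set q : χ → ℝ := fun x => (Q.rnDeriv ν x).toReal with hq
  have hpi : Integrable p ν := Measure.integrable_toReal_rnDeriv
  have hqi : Integrable q ν := Measure.integrable_toReal_rnDeriv
  have hp1 : ∫ x, p x ∂ν = 1 := by
    rw [Measure.integral_toReal_rnDeriv hPν]; simp
  have hq1 : ∫ x, q x ∂ν = 1 := by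
    rw [Measure.integral_toReal_rnDeriv hQν]; simp
  have hGb : ∀ x, ‖G x‖ ≤ |a| + |b| := fun x => by
    rw [Real.norm_eq_abs]
    rcases abs_cases (G x) with h | h <;> rcases abs_cases a with h' | h' <;>
      rcases abs_cases b with h'' | h'' <;> linarith [ha x, hb x]
  have hpG : Integrable (fun x => p x * G x) ν :=
    hpi.mul_bdd hG.aestronglyMeasurable (Filter.Eventually.of_forall hGb)
  have hqG : Integrable (fun x => q x * G x) ν :=
    hqi.mul_bdd hG.aestronglyMeasurable (Filter.Eventually.of_forall hGb)
  have eP : ∫ x, G x ∂P = ∫ x, p x * G x ∂ν := by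
    rw [← integral_rnDeriv_smul hPν]; rfl
  have eQ : ∫ x, G x ∂Q = ∫ x, q x * G x ∂ν := by
    rw [← integral_rnDeriv_smul hQν]; rfl
  have key : ∫ x, p x * G x ∂ν - ∫ x, q x * G x ∂ν
      = ∫ x, (p x - q x) * (G x - (a + b) / 2) ∂ν := by
    have e : (fun x => (p x - q x) * (G x - (a + b) / 2)) =
        fun x => (p x * G x - q x * G x) - (a + b) / 2 * (p x - q x) := by
      funext x; ring
    have e' : ∫ x, (p x * G x - q x * G x) - (a + b) / 2 * (p x - q x) ∂ν =
        ∫ x, p x * G x - q x * G x ∂ν - ∫ x, (a + b) / 2 * (p x - q x) ∂ν :=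
      integral_sub (hpG.sub hqG) ((hpi.sub hqi).const_mul _)
    rw [e, e', integral_sub hpG hqG, integral_const_mul, integral_sub hpi hqi, hp1, hq1]
    ring
  rw [eP, eQ, key]
  calc ∫ x, (p x - q x) * (G x - (a + b) / 2) ∂ν
      ≤ ∫ x, |p x - q x| * ((b - a) / 2) ∂ν := by
        refine integral_mono ?_ ((hpi.sub hqi).abs.mul_const _) fun x => ?_
        · refine (hpi.sub hqi).mul_bdd (c := |a| + |b| + |(a + b) / 2|)
            (hG.sub_const _).aestronglyMeasurable
            (Filter.Eventually.of_forall fun x => ?_)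
          exact (norm_sub_le _ _).trans (by gcongr; exact hGb x; exact le_rfl)
        · have h1 : |G x - (a + b) / 2| ≤ (b - a) / 2 := by
            rw [abs_le]; constructor <;> linarith [ha x, hb x]
          calc (p x - q x) * (G x - (a + b) / 2) ≤ |(p x - q x) * (G x - (a + b) / 2)| :=
                le_abs_self _
            _ = |p x - q x| * |G x - (a + b) / 2| := abs_mul _ _
            _ ≤ _ := by gcongr
    _ = 1 / 2 * (∫ x, |p x - q x| ∂ν) * (b - a) := by
        rw [integral_mul_const]; ring

lemma tvDist_self (P : Measure χ) : tvDist P P = 0 := by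
  simp [tvDist]

/-- The densities relative to `P + Q = (1 + g) P` are `1 / (1 + g)` and `g / (1 + g)`. Then `|1 - g|
= 2 max (1 - g) 0 - (1 - g)`, and the last term has mean zero. -/
lemma tvDist_withDensity (P : Measure χ) [IsProbabilityMeasure P] {g : χ → ℝ}
    (hg : Measurable g) (hg0 : ∀ x, 0 ≤ g x) (hgi : Integrable g P) (hg1 : ∫ x, g x ∂P = 1) :
    tvDist P (P.withDensity fun x => ENNReal.ofReal (g x)) = ∫ x, max (1 - g x) 0 ∂P := by
  set Q := P.withDensity fun x => ENNReal.ofReal (g x) with hQ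
  have hQp : IsProbabilityMeasure Q := by
    refine ⟨?_⟩
    rw [hQ, withDensity_apply _ MeasurableSet.univ, Measure.restrict_univ,
      ← ofReal_integral_eq_lintegral_ofReal hgi (Filter.Eventually.of_forall hg0), hg1]
    simp
  have hν : P + Q = P.withDensity fun x => ENNReal.ofReal (1 + g x) := by
    have : (fun x => ENNReal.ofReal (1 + g x)) =
        (fun _ => (1 : ℝ≥0∞)) + fun x => ENNReal.ofReal (g x) := by
      funext x; simp [ENNReal.ofReal_add zero_le_one (hg0 x)]
    rw [this, withDensity_add_left measurable_const, hQ]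
    congr 1
    exact withDensity_one.symm
  have hm : Measurable fun x => ENNReal.ofReal (1 + g x) := by fun_prop
  have h1 : ∀ x, 0 < 1 + g x := fun x => by linarith [hg0 x]
  have hPd : P = (P + Q).withDensity fun x => ENNReal.ofReal (1 / (1 + g x)) := by
    rw [hν, ← withDensity_mul _ hm (by fun_prop)]
    have : ((fun x => ENNReal.ofReal (1 + g x)) * fun x => ENNReal.ofReal (1 / (1 + g x)))
        = 1 := by
      funext x
      simp only [Pi.mul_apply, Pi.one_apply]
      rw [← ENNReal.ofReal_mul (h1 x).le, mul_one_div_cancel (h1 x).ne', ENNReal.ofReal_one]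
    rw [this, withDensity_one]
  have hQd : Q = (P + Q).withDensity fun x => ENNReal.ofReal (g x / (1 + g x)) := by
    rw [hν, ← withDensity_mul _ hm (by fun_prop), hQ]
    congr 1
    funext x
    simp only [Pi.mul_apply]
    rw [← ENNReal.ofReal_mul (h1 x).le, mul_div_cancel₀ _ (h1 x).ne']
  have hPr : (fun x => ENNReal.ofReal (1 / (1 + g x))) =ᵐ[P + Q] P.rnDeriv (P + Q) :=
    Measure.eq_rnDeriv (by fun_prop) Measure.MutuallySingular.zero_left (by rwa [zero_add])
  have hQr : (fun x => ENNReal.ofReal (g x / (1 + g x))) =ᵐ[P + Q] Q.rnDeriv (P + Q) :=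
    Measure.eq_rnDeriv (by fun_prop) Measure.MutuallySingular.zero_left (by rwa [zero_add])
  have e1 : tvDist P Q = (1 / 2) * ∫ x, |1 / (1 + g x) - g x / (1 + g x)| ∂(P + Q) := by
    unfold tvDist
    congr 1
    refine integral_congr_ae ?_
    filter_upwards [hPr, hQr] with x hx hy
    rw [← hx, ← hy, ENNReal.toReal_ofReal (one_div_pos.2 (h1 x)).le,
      ENNReal.toReal_ofReal (div_nonneg (hg0 x) (h1 x).le)]
  rw [e1, hν, integral_withDensity_eq_integral_toReal_smul hm
    (Filter.Eventually.of_forall fun _ => ENNReal.ofReal_lt_top)]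
  have e2 : ∀ x, (ENNReal.ofReal (1 + g x)).toReal • |1 / (1 + g x) - g x / (1 + g x)|
      = 2 * max (1 - g x) 0 - (1 - g x) := fun x => by
    rw [ENNReal.toReal_ofReal (h1 x).le, ← sub_div, abs_div, abs_of_pos (h1 x), smul_eq_mul,
      mul_div_cancel₀ _ (h1 x).ne']
    rcases le_total (1 - g x) 0 with h | h
    · rw [abs_of_nonpos h, max_eq_right h]; ring
    · rw [abs_of_nonneg h, max_eq_left h]; ring
  simp_rw [e2]
  have hi : Integrable (fun x => 1 - g x) P := (integrable_const _).sub hgi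
  have hi' : Integrable (fun x => max (1 - g x) 0) P := hi.pos_part
  rw [integral_sub (hi'.const_mul _) hi, integral_const_mul,
    integral_sub (integrable_const _) hgi, hg1]
  simp

end TotalVariation

/-! ### Lower bound for private estimation at two points -/

section GroupPrivacy

variable {χ : Type*} [MeasurableSpace χ]

/-- The ratio condition confines `G` to `[a, e^ε a]` with `a = inf G`. The change of integral is
therefore at most `TV (e^ε - 1) a`, and `a ≤ ∫ G dQ` makes this a relative error. -/
lemma lintegral_le_of_tvDist (P Q : Measure χ) [IsProbabilityMeasure P] [IsProbabilityMeasure Q]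
    {ε : ℝ} {G : χ → ℝ≥0∞} (hG : Measurable G) (hG1 : ∀ x, G x ≤ 1)
    (hGε : ∀ x y, G x ≤ ENNReal.ofReal (Real.exp ε) * G y) :
    ∫⁻ x, G x ∂P ≤ ENNReal.ofReal (1 + tvDist P Q * (Real.exp ε - 1)) * ∫⁻ x, G x ∂Q := by
  have hne : ∀ x, G x ≠ ⊤ := fun x => ((hG1 x).trans_lt ENNReal.one_lt_top).ne
  have hχ : Nonempty χ := nonempty_of_isProbabilityMeasure P
  set g : χ → ℝ := fun x => (G x).toReal
  have hgm : Measurable g := hG.ennreal_toReal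
  have hg0 : ∀ x, 0 ≤ g x := fun x => ENNReal.toReal_nonneg
  have hg1 : ∀ x, g x ≤ 1 := fun x => by
    simpa using ENNReal.toReal_mono ENNReal.one_ne_top (hG1 x)
  have hge : ∀ x y, g x ≤ Real.exp ε * g y := fun x y => by
    have := ENNReal.toReal_mono (ENNReal.mul_ne_top ENNReal.ofReal_ne_top (hne y)) (hGε x y)
    rwa [ENNReal.toReal_mul, ENNReal.toReal_ofReal (Real.exp_pos _).le] at this
  have hbdd : BddBelow (Set.range g) := ⟨0, by rintro _ ⟨x, rfl⟩; exact hg0 x⟩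
  set a := ⨅ x, g x
  have ha : ∀ x, a ≤ g x := fun x => ciInf_le hbdd x
  have hb : ∀ x, g x ≤ Real.exp ε * a := fun x => by
    have : Real.exp (-ε) * g x ≤ a := le_ciInf fun y => by
      calc Real.exp (-ε) * g x ≤ Real.exp (-ε) * (Real.exp ε * g y) := by gcongr; exact hge x y
        _ = g y := by rw [← mul_assoc, ← Real.exp_add]; simp
    calc g x = Real.exp ε * (Real.exp (-ε) * g x) := by
          rw [← mul_assoc, ← Real.exp_add]; simp
      _ ≤ _ := by gcongr
  have hint : ∀ T : Measure χ, IsProbabilityMeasure T → Integrable g T := fun T _ =>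
    Integrable.of_bound hgm.aestronglyMeasurable 1 (Filter.Eventually.of_forall fun x => by
      rw [Real.norm_eq_abs, abs_of_nonneg (hg0 x)]; exact hg1 x)
  have hlin : ∀ T : Measure χ, IsProbabilityMeasure T →
      ∫⁻ x, G x ∂T = ENNReal.ofReal (∫ x, g x ∂T) := fun T hR => by
    rw [ofReal_integral_eq_lintegral_ofReal (hint T hR) (Filter.Eventually.of_forall hg0)]
    exact lintegral_congr fun x => (ENNReal.ofReal_toReal (hne x)).symm
  have haQ : a ≤ ∫ x, g x ∂Q := by
    calc a = ∫ _, a ∂Q := by simp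
      _ ≤ _ := integral_mono (integrable_const _) (hint Q inferInstance) ha
  have ha0 : 0 ≤ a := le_ciInf hg0
  have htv := tvDist_nonneg P Q
  have hmain := integral_sub_integral_le_tvDist P Q hgm ha hb
  have hx : 0 ≤ Real.exp ε * a - a := by
    obtain ⟨x⟩ := hχ
    linarith [ha x, hb x]
  rw [hlin P inferInstance, hlin Q inferInstance]
  -- If `a = 0` then `G` vanishes identically; if `a > 0` then `a ≤ e^ε a` forces `e^ε ≥ 1`, which
  -- is not assumed.
  rcases ha0.eq_or_lt with h0 | h0
  · have : ∀ x, g x = 0 := fun x => le_antisymm (by simpa [← h0] using hb x) (hg0 x)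
    simp [this]
  have he : 0 ≤ Real.exp ε - 1 := by
    by_contra hcon
    nlinarith
  rw [← ENNReal.ofReal_mul (by positivity)]
  apply ENNReal.ofReal_le_ofReal
  have : tvDist P Q * (Real.exp ε * a - a) ≤
      tvDist P Q * ((Real.exp ε - 1) * ∫ x, g x ∂Q) := by
    gcongr
    nlinarith
  nlinarith

/-- Hybrid argument: with the first coordinate fixed, induction replaces `P` by `Q` in the others.
Averaging over these preserves both the bound by `1` and the ratio condition in the first
coordinate, so `hstep` replaces that one too. -/
lemma lintegral_pi_le_pow {P Q : Measure χ} [IsProbabilityMeasure P] [IsProbabilityMeasure Q]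
    {c r : ℝ≥0∞} (hstep : ∀ G : χ → ℝ≥0∞, Measurable G → (∀ x, G x ≤ 1) →
      (∀ x y, G x ≤ r * G y) → ∫⁻ x, G x ∂P ≤ c * ∫⁻ x, G x ∂Q) :
    ∀ (n : ℕ) (F : (Fin n → χ) → ℝ≥0∞), Measurable F → (∀ x, F x ≤ 1) →
      (∀ x y : Fin n → χ, (∃ i, ∀ j, j ≠ i → x j = y j) → F x ≤ r * F y) →
      ∫⁻ x, F x ∂(Measure.pi fun _ => P) ≤ c ^ n * ∫⁻ x, F x ∂(Measure.pi fun _ => Q)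
  | 0, F, _, _, _ => by simp [lintegral_unique]
  | n + 1, F, hF, hF1, hFr => by
    have hcons : Measurable fun z : χ × (Fin n → χ) => F (Fin.cons z.1 z.2) := by
      refine hF.comp (measurable_pi_iff.2 fun j => ?_)
      refine Fin.cases ?_ (fun j => ?_) j
      · simpa using measurable_fst
      · simpa [Function.comp_def] using (measurable_pi_apply j).comp measurable_snd
    have hrw : ∀ (T : Measure χ) [IsProbabilityMeasure T],
        ∫⁻ x, F x ∂(Measure.pi fun _ : Fin (n + 1) => T) =
          ∫⁻ a, ∫⁻ x, F (Fin.cons a x) ∂(Measure.pi fun _ : Fin n => T) ∂T := fun T _ => by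
      have h := (measurePreserving_piFinSuccAbove (fun _ : Fin (n + 1) => T) 0).symm
      rw [← h.lintegral_comp hF, ← lintegral_prod _ hcons.aemeasurable]
      refine lintegral_congr fun z => ?_
      simp [MeasurableEquiv.piFinSuccAbove_symm_apply, Fin.insertNthEquiv]
    rw [hrw P, hrw Q]
    calc ∫⁻ a, ∫⁻ x, F (Fin.cons a x) ∂(Measure.pi fun _ : Fin n => P) ∂P
        ≤ ∫⁻ a, c ^ n * ∫⁻ x, F (Fin.cons a x) ∂(Measure.pi fun _ : Fin n => Q) ∂P := by
          refine lintegral_mono fun a => lintegral_pi_le_pow hstep n _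
            (hcons.comp measurable_prodMk_left) (fun _ => hF1 _) fun x y ⟨i, hi⟩ => hFr _ _ ?_
          refine ⟨i.succ, fun j => Fin.cases (fun _ => by simp) (fun j hj => ?_) j⟩
          simpa using hi j fun h => hj (by rw [h])
      _ = c ^ n * ∫⁻ a, ∫⁻ x, F (Fin.cons a x) ∂(Measure.pi fun _ : Fin n => Q) ∂P :=
          lintegral_const_mul _ hcons.lintegral_prod_right'
      _ ≤ c ^ n * (c * ∫⁻ a, ∫⁻ x, F (Fin.cons a x) ∂(Measure.pi fun _ : Fin n => Q) ∂Q) := by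
          gcongr
          refine hstep _ hcons.lintegral_prod_right' (fun a => ?_) fun a b => ?_
          · calc _ ≤ ∫⁻ _, 1 ∂(Measure.pi fun _ : Fin n => Q) := lintegral_mono fun _ => hF1 _
              _ = 1 := by simp
          · have hb : Measurable fun x => F (Fin.cons b x) := hcons.comp measurable_prodMk_left
            rw [← lintegral_const_mul _ hb]
            refine lintegral_mono fun x => hFr _ _ ⟨0, fun j => ?_⟩
            exact Fin.cases (fun h => absurd rfl h) (fun j _ => by simp) j
      _ = _ := by rw [← mul_assoc, pow_succ]

/-- If both error rates were below `|t - s| / 2`, the success intervals around `s` and `t` would be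
disjoint. The one around `s` then has mass at most `1/4` under `Q`, hence at most `e / 4 < 3 / 4`
under `P`. -/
lemma ofReal_half_abs_sub_le_max_errorRate {P Q : Measure χ} [IsProbabilityMeasure P]
    [IsProbabilityMeasure Q] {n : ℕ} {ε s t : ℝ} (hε : 0 ≤ ε)
    (hsmall : n * (tvDist P Q * (Real.exp ε - 1)) ≤ 1) {M : Kernel (Fin n → χ) ℝ}
    (hM : M ∈ dpEstimators χ n ε) :
    ENNReal.ofReal (|t - s| / 2) ≤ max (errorRate M P s) (errorRate M Q t) := by
  obtain ⟨hMk, hMdp⟩ := hM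
  by_contra! hlt
  obtain ⟨h1, h2⟩ := max_lt_iff.1 hlt
  simp only [errorRate, iInf_lt_iff] at h1 h2
  obtain ⟨α, hα, hα'⟩ := h1
  obtain ⟨γ, hγ, hγ'⟩ := h2
  rw [← ENNReal.ofReal_coe_nnreal] at hα' hγ'
  have hα₂ : (α : ℝ) < |t - s| / 2 := (ENNReal.ofReal_lt_ofReal_iff_of_nonneg α.2).1 hα'
  have hγ₂ : (γ : ℝ) < |t - s| / 2 := (ENNReal.ofReal_lt_ofReal_iff_of_nonneg γ.2).1 hγ'
  set A := {y : ℝ | |y - s| ≤ α}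
  set B := {y : ℝ | |y - t| ≤ γ}
  have hA : MeasurableSet A := measurableSet_le (by fun_prop) measurable_const
  have hB : MeasurableSet B := measurableSet_le (by fun_prop) measurable_const
  have hdisj : Disjoint A B := Set.disjoint_left.2 fun y hy hy' => by
    have h3 : |t - s| ≤ |y - s| + |y - t| := by
      have := abs_sub (y - s) (y - t)
      rwa [show y - s - (y - t) = t - s by ring] at this
    have h4 : |y - s| ≤ α := hy
    have h5 : |y - t| ≤ γ := hy'
    linarith
  have hbind : ∀ T : Measure χ, IsProbabilityMeasure T →
      (M ∘ₘ (Measure.pi fun _ : Fin n => T)) A = ∫⁻ x, M x A ∂(Measure.pi fun _ : Fin n => T) :=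
    fun T _ => Measure.bind_apply hA M.aemeasurable
  have hgroup := lintegral_pi_le_pow (P := P) (Q := Q)
    (fun G hG hG1 hGr => lintegral_le_of_tvDist P Q (ε := ε) hG hG1 hGr) n (fun x => M x A)
    (M.measurable_coe hA) (fun x => prob_le_one) (fun x y hxy => hMdp x y hxy A hA)
  rw [← hbind P inferInstance, ← hbind Q inferInstance] at hgroup
  have hsum : (M ∘ₘ (Measure.pi fun _ : Fin n => Q)) A + 3 / 4 ≤ 1 := by
    calc _ ≤ (M ∘ₘ (Measure.pi fun _ : Fin n => Q)) A +
          (M ∘ₘ (Measure.pi fun _ : Fin n => Q)) B := by gcongr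
      _ = (M ∘ₘ (Measure.pi fun _ : Fin n => Q)) (A ∪ B) := (measure_union hdisj hB).symm
      _ ≤ 1 := prob_le_one
  have hge := hα.trans hgroup
  set m := (M ∘ₘ (Measure.pi fun _ : Fin n => Q)) A
  have hmtop : m ≠ ⊤ := measure_ne_top _ _
  have he0 : 0 ≤ tvDist P Q * (Real.exp ε - 1) :=
    mul_nonneg (tvDist_nonneg P Q) (by linarith [Real.add_one_le_exp ε])
  have hc : ENNReal.ofReal (1 + tvDist P Q * (Real.exp ε - 1)) ^ n ≤ ENNReal.ofReal (Real.exp 1) := by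
    rw [← ENNReal.ofReal_pow (by linarith)]
    apply ENNReal.ofReal_le_ofReal
    calc (1 + tvDist P Q * (Real.exp ε - 1)) ^ n
        ≤ Real.exp (tvDist P Q * (Real.exp ε - 1)) ^ n := by
          gcongr
          linarith [Real.add_one_le_exp (tvDist P Q * (Real.exp ε - 1))]
      _ = Real.exp (n * (tvDist P Q * (Real.exp ε - 1))) := (Real.exp_nat_mul _ _).symm
      _ ≤ _ := Real.exp_le_exp.2 hsmall
  have hge' : (3 / 4 : ℝ≥0∞) ≤ ENNReal.ofReal (Real.exp 1) * m := hge.trans (by gcongr)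
  have r1 := ENNReal.toReal_mono (ENNReal.mul_ne_top ENNReal.ofReal_ne_top hmtop) hge'
  have r2 := ENNReal.toReal_mono ENNReal.one_ne_top hsum
  rw [ENNReal.toReal_mul, ENNReal.toReal_ofReal (Real.exp_pos _).le] at r1
  rw [ENNReal.toReal_add hmtop (by finiteness)] at r2
  simp only [ENNReal.toReal_div, ENNReal.toReal_ofNat, ENNReal.toReal_one] at r1 r2
  have := Real.exp_one_lt_d9
  nlinarith [Real.exp_pos 1]

end GroupPrivacy

/-! ### Private two-point tests -/

section Testing

variable {χ : Type*} [MeasurableSpace χ]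

/-- The kernel that outputs `s` with probability `w x` and `t` with probability `1 - w x`. -/
noncomputable def twoPointKernel {n : ℕ} (w : (Fin n → χ) → ℝ) (hw : Measurable w) (s t : ℝ) :
    Kernel (Fin n → χ) ℝ where
  toFun x := ENNReal.ofReal (w x) • Measure.dirac s + ENNReal.ofReal (1 - w x) • Measure.dirac t
  measurable' := by
    refine Measure.measurable_of_measurable_coe _ fun E _ => ?_
    simp only [Measure.coe_add, Measure.coe_smul, Pi.add_apply, Pi.smul_apply, smul_eq_mul]
    fun_prop

lemma twoPointKernel_apply {n : ℕ} {w : (Fin n → χ) → ℝ} (hw : Measurable w) (s t : ℝ)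
    (x : Fin n → χ) (E : Set ℝ) : twoPointKernel w hw s t x E =
      ENNReal.ofReal (w x) * Measure.dirac s E + ENNReal.ofReal (1 - w x) * Measure.dirac t E := by
  simp [twoPointKernel]

lemma twoPointKernel_mem_dpEstimators {n : ℕ} {ε : ℝ} {w : (Fin n → χ) → ℝ} (hw : Measurable w)
    (hw0 : ∀ x, 0 ≤ w x) (hw1 : ∀ x, w x ≤ 1)
    (hdp : ∀ x y : Fin n → χ, (∃ i, ∀ j, j ≠ i → x j = y j) →
      w x ≤ Real.exp ε * w y ∧ 1 - w x ≤ Real.exp ε * (1 - w y)) (s t : ℝ) :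
    twoPointKernel w hw s t ∈ dpEstimators χ n ε := by
  refine ⟨⟨fun x => ⟨?_⟩⟩, fun x y hxy E _ => ?_⟩
  · rw [twoPointKernel_apply]
    simp only [measure_univ, mul_one]
    rw [← ENNReal.ofReal_add (hw0 x) (by linarith [hw1 x])]
    simp
  · rw [twoPointKernel_apply, twoPointKernel_apply, mul_add, ← mul_assoc, ← mul_assoc,
      ← ENNReal.ofReal_mul (Real.exp_pos _).le, ← ENNReal.ofReal_mul (Real.exp_pos _).le]
    obtain ⟨h1, h2⟩ := hdp x y hxy
    gcongr

lemma errorRate_eq_zero {n : ℕ} {M : Kernel (Fin n → χ) ℝ} {P : Measure χ} {t : ℝ}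
    {w : (Fin n → χ) → ℝ} [IsProbabilityMeasure P] (hw : Measurable w) (hw0 : ∀ x, 0 ≤ w x)
    (hw1 : ∀ x, w x ≤ 1) (hM : ∀ x, ENNReal.ofReal (1 - w x) ≤ M x {t})
    (hint : ∫ x, w x ∂(Measure.pi fun _ : Fin n => P) ≤ 1 / 4) : errorRate M P t = 0 := by
  refine le_antisymm (iInf₂_le_of_le 0 ?_ (by simp)) bot_le
  have hset : {y : ℝ | |y - t| ≤ ((0 : ℝ≥0) : ℝ)} = {t} := by
    ext y; simp [sub_eq_zero]
  rw [hset, Measure.bind_apply (measurableSet_singleton t) M.aemeasurable]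
  have hwi : Integrable w (Measure.pi fun _ : Fin n => P) :=
    Integrable.of_bound hw.aestronglyMeasurable 1 (Filter.Eventually.of_forall fun x => by
      rw [Real.norm_eq_abs, abs_of_nonneg (hw0 x)]; exact hw1 x)
  calc (3 / 4 : ℝ≥0∞) = ENNReal.ofReal (3 / 4) := by
        rw [ENNReal.ofReal_div_of_pos (by norm_num)]; simp
    _ ≤ ENNReal.ofReal (∫ x, (1 - w x) ∂(Measure.pi fun _ : Fin n => P)) := by
        apply ENNReal.ofReal_le_ofReal
        rw [integral_sub (integrable_const _) hwi]
        simp only [integral_const, probReal_univ, smul_eq_mul, mul_one]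
        linarith
    _ = ∫⁻ x, ENNReal.ofReal (1 - w x) ∂(Measure.pi fun _ : Fin n => P) :=
        ofReal_integral_eq_lintegral_ofReal ((integrable_const _).sub hwi)
          (Filter.Eventually.of_forall fun x => sub_nonneg.2 (hw1 x))
    _ ≤ _ := lintegral_mono hM

lemma exp_le_of_abs_le {y ε : ℝ} (h : |y| ≤ ε) :
    Real.exp y ≤ 1 + y + ε ^ 2 * Real.exp ε := by
  have := Complex.norm_exp_sub_sum_le_norm_mul_exp (y : ℂ) 2
  rw [Finset.sum_range_succ, Finset.sum_range_one] at this
  simp only [pow_zero, Nat.factorial, Nat.cast_one, div_one, pow_one, mul_one,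
    Complex.norm_real, Real.norm_eq_abs] at this
  rw [← Complex.ofReal_exp, ← Complex.ofReal_one, ← Complex.ofReal_add, ← Complex.ofReal_sub,
    Complex.norm_real, Real.norm_eq_abs] at this
  have h2 : |y| ^ 2 * Real.exp |y| ≤ ε ^ 2 * Real.exp ε := by gcongr
  linarith [le_abs_self (Real.exp y - (1 + y))]

/-- The integral factorises over the coordinates; each factor is expanded to second order and
bounded by `1 + y ≤ e^y`. -/
lemma integral_exp_sum_le {P : Measure χ} [IsProbabilityMeasure P] {u : χ → ℝ}
    (hu : Measurable u) {ε : ℝ} (huε : ∀ x, |u x| ≤ ε) (n : ℕ) :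
    ∫ x, Real.exp (∑ i, u (x i)) ∂(Measure.pi fun _ : Fin n => P) ≤
      Real.exp (n * (∫ x, u x ∂P + ε ^ 2 * Real.exp ε)) := by
  have hui : Integrable u P :=
    Integrable.of_bound hu.aestronglyMeasurable ε (Filter.Eventually.of_forall huε)
  have hei : Integrable (fun x => Real.exp (u x)) P :=
    Integrable.of_bound (by fun_prop) (Real.exp ε) (Filter.Eventually.of_forall fun x => by
      rw [Real.norm_eq_abs, abs_of_pos (Real.exp_pos _)]
      exact Real.exp_le_exp.2 ((le_abs_self _).trans (huε x)))
  simp_rw [Real.exp_sum]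
  rw [integral_fintype_prod_eq_pow (fun x => Real.exp (u x)), Fintype.card_fin, Real.exp_nat_mul]
  have h0 : 0 ≤ ∫ x, Real.exp (u x) ∂P := integral_nonneg fun _ => (Real.exp_pos _).le
  refine pow_le_pow_left₀ h0 ?_ n
  calc ∫ x, Real.exp (u x) ∂P ≤ ∫ x, (1 + u x + ε ^ 2 * Real.exp ε) ∂P :=
        integral_mono hei (((integrable_const _).add hui).add (integrable_const _))
          fun x => exp_le_of_abs_le (huε x)
    _ = 1 + ∫ x, u x ∂P + ε ^ 2 * Real.exp ε := by
        rw [integral_add (by fun_prop) (integrable_const _), integral_add (integrable_const _) hui]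
        simp
    _ ≤ _ := by
        linarith [Real.add_one_le_exp (∫ x, u x ∂P + ε ^ 2 * Real.exp ε)]

lemma sigmoid_le_exp (a : ℝ) : Real.sigmoid a ≤ Real.exp a := by
  rw [Real.sigmoid_def, Real.exp_neg, inv_le_comm₀ (by positivity) (by positivity)]
  linarith [Real.exp_pos a]

lemma sigmoid_le_exp_mul {a b ε : ℝ} (hε : 0 ≤ ε) (h : a - b ≤ ε) :
    Real.sigmoid a ≤ Real.exp ε * Real.sigmoid b := by
  rw [Real.sigmoid_def, Real.sigmoid_def, ← div_eq_mul_inv, ← one_div (1 + Real.exp (-a)),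
    div_le_div_iff₀ (by positivity) (by positivity), one_mul, mul_add, mul_one,
    ← Real.exp_add]
  have h1 := Real.one_le_exp hε
  have h2 : Real.exp (-b) ≤ Real.exp (ε + -a) := Real.exp_le_exp.2 (by linarith)
  linarith

/-- The estimator outputs `s` with log-odds `U = ε (#{i | x i ∈ S} - n c)`. One record moves `U` by
at most `ε`, which gives privacy. Centring at the midpoint `c` gives `U` the means `± n ε (P S - Q
S) / 2` under `P` and `Q`. Since the sigmoid is below `exp`, a Chernoff bound makes each probability
of a wrong answer at most `e⁻² ≤ 1/4`. -/
lemma exists_dpEstimator_errorRate_eq_zero {P Q : Measure χ} [IsProbabilityMeasure P]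
    [IsProbabilityMeasure Q] {S : Set χ} (hS : MeasurableSet S) {n : ℕ} {ε : ℝ} (hε : 0 ≤ ε)
    (hsep : 2 + n * (ε ^ 2 * Real.exp ε) ≤ n * (ε * ((P.real S - Q.real S) / 2))) (s t : ℝ) :
    ∃ M ∈ dpEstimators χ n ε, errorRate M P s = 0 ∧ errorRate M Q t = 0 := by
  set c := (P.real S + Q.real S) / 2 with hc
  have hc0 : 0 ≤ c := by positivity
  have hc1 : c ≤ 1 := by
    have h1 : P.real S ≤ 1 := measureReal_le_one
    have h2 : Q.real S ≤ 1 := measureReal_le_one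
    linarith
  set u : χ → ℝ := fun x => ε * (S.indicator 1 x - c) with hu
  have hum : Measurable u := ((measurable_one.indicator hS).sub_const c).const_mul ε
  have hind : ∀ x, S.indicator (1 : χ → ℝ) x = 0 ∨ S.indicator (1 : χ → ℝ) x = 1 := fun x => by
    by_cases h : x ∈ S <;> simp [h]
  have huε : ∀ x, |u x| ≤ ε := fun x => by
    rw [hu, abs_mul, abs_of_nonneg hε]
    refine mul_le_of_le_one_right hε (abs_le.2 ?_)
    rcases hind x with h | h <;> rw [h] <;> constructor <;> linarith
  have hudiff : ∀ x y, u x - u y ≤ ε := fun x y => by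
    have : u x - u y = ε * (S.indicator 1 x - S.indicator 1 y) := by simp only [hu]; ring
    rw [this]
    refine mul_le_of_le_one_right hε ?_
    rcases hind x with h | h <;> rcases hind y with h' | h' <;> rw [h, h'] <;> norm_num
  have hui : ∀ T : Measure χ, IsProbabilityMeasure T → ∫ x, u x ∂T = ε * (T.real S - c) :=
    fun T _ => by
      rw [hu, integral_const_mul, integral_sub ((integrable_const 1).indicator hS)
        (integrable_const _), integral_indicator_one hS]
      simp
  set U : (Fin n → χ) → ℝ := fun x => ∑ i, u (x i) with hU
  have hUm : Measurable U := by fun_prop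
  have hUdiff : ∀ x y : Fin n → χ, (∃ i, ∀ j, j ≠ i → x j = y j) → U x - U y ≤ ε := by
    rintro x y ⟨i, hi⟩
    rw [hU, ← Finset.sum_sub_distrib, Finset.sum_eq_single i (fun j _ hj => by simp [hi j hj])
      (by simp)]
    exact hudiff _ _
  set w : (Fin n → χ) → ℝ := fun x => Real.sigmoid (U x) with hw
  have hwm : Measurable w := continuous_sigmoid.measurable.comp hUm
  have hw' : ∀ x, 1 - w x = Real.sigmoid (-U x) := fun x => (Real.sigmoid_neg _).symm
  have hquarter : Real.exp (-2) ≤ 1 / 4 := by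
    rw [show (-2 : ℝ) = -1 + -1 by norm_num, Real.exp_add]
    have := Real.exp_neg_one_lt_d9
    nlinarith [Real.exp_pos (-1)]
  -- Chernoff bound for both kinds of error: it is used with `r = -u` under `P` and with `r = u`
  -- under `Q`.
  have hbound : ∀ (T : Measure χ) (v : (Fin n → χ) → ℝ) (r : χ → ℝ), IsProbabilityMeasure T →
      Measurable v → (∀ x, 0 ≤ v x) → (∀ x, v x ≤ Real.exp (∑ i, r (x i))) → Measurable r →
      (∀ x, |r x| ≤ ε) → n * (∫ x, r x ∂T + ε ^ 2 * Real.exp ε) ≤ -2 →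
      ∫ x, v x ∂(Measure.pi fun _ : Fin n => T) ≤ 1 / 4 := by
    intro T v r _ hv hv0 hvr hr hrε hle
    have hei : Integrable (fun x : Fin n → χ => Real.exp (∑ i, r (x i)))
        (Measure.pi fun _ : Fin n => T) :=
      Integrable.of_bound (Measurable.aestronglyMeasurable (by fun_prop)) (Real.exp (n * ε)) (Filter.Eventually.of_forall fun x => by
        rw [Real.norm_eq_abs, abs_of_pos (Real.exp_pos _)]
        refine Real.exp_le_exp.2 ((Finset.sum_le_sum fun i _ =>
          (le_abs_self _).trans (hrε (x i))).trans ?_)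
        simp)
    calc ∫ x, v x ∂(Measure.pi fun _ : Fin n => T)
        ≤ ∫ x, Real.exp (∑ i, r (x i)) ∂(Measure.pi fun _ : Fin n => T) :=
          integral_mono_of_nonneg (Filter.Eventually.of_forall hv0) hei
            (Filter.Eventually.of_forall hvr)
      _ ≤ _ := integral_exp_sum_le hr hrε n
      _ ≤ Real.exp (-2) := Real.exp_le_exp.2 hle
      _ ≤ _ := hquarter
  refine ⟨twoPointKernel w hwm s t, twoPointKernel_mem_dpEstimators hwm
    (fun x => Real.sigmoid_nonneg _) (fun x => Real.sigmoid_le_one _) (fun x y hxy => ⟨?_, ?_⟩) s t,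
    ?_, ?_⟩
  · exact sigmoid_le_exp_mul hε (hUdiff x y hxy)
  · rw [hw', hw']
    refine sigmoid_le_exp_mul hε ?_
    have := hUdiff y x (hxy.imp fun i hi j hj => (hi j hj).symm)
    linarith
  · refine errorRate_eq_zero (w := fun x => 1 - w x) (by fun_prop)
      (fun x => by rw [hw']; exact Real.sigmoid_nonneg _)
      (fun x => by rw [hw']; exact Real.sigmoid_le_one _) (fun x => ?_) ?_
    · rw [twoPointKernel_apply]
      simp
    · refine hbound P _ (fun x => -u x) inferInstance (by fun_prop)
        (fun x => by rw [hw']; exact Real.sigmoid_nonneg _) (fun x => ?_) hum.neg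
        (fun x => by rw [abs_neg]; exact huε x) ?_
      · rw [hw', Finset.sum_neg_distrib]
        exact sigmoid_le_exp _
      · rw [integral_neg, hui P inferInstance, hc]
        linarith
  · refine errorRate_eq_zero hwm (fun x => Real.sigmoid_nonneg _)
      (fun x => Real.sigmoid_le_one _) (fun x => ?_) ?_
    · rw [twoPointKernel_apply]
      simp
    · refine hbound Q _ u inferInstance hwm (fun x => Real.sigmoid_nonneg _)
        (fun x => sigmoid_le_exp _) hum huε ?_
      rw [hui Q inferInstance, hc]
      linarith

lemma exists_dpEstimator_const {P Q : Measure χ} [IsProbabilityMeasure P]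
    [IsProbabilityMeasure Q] (n : ℕ) {ε : ℝ} (hε : 0 ≤ ε) (s t : ℝ) :
    ∃ M ∈ dpEstimators χ n ε, errorRate M P s ≤ ENNReal.ofReal |s - t| ∧
      errorRate M Q t ≤ ENNReal.ofReal |s - t| := by
  refine ⟨Kernel.const _ (Measure.dirac s), ⟨inferInstance, fun x y _ E _ => ?_⟩, ?_, ?_⟩
  · simp only [Kernel.const_apply]
    exact le_mul_of_one_le_left bot_le (by simpa using Real.one_le_exp hε)
  · refine iInf₂_le_of_le |s - t|.toNNReal ?_ le_rfl
    simp only [Measure.const_comp, measure_univ, one_smul]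
    rw [Measure.dirac_apply_of_mem (by simp)]
    exact ENNReal.div_le_of_le_mul (by norm_num)
  · refine iInf₂_le_of_le |s - t|.toNNReal ?_ le_rfl
    simp only [Measure.const_comp, measure_univ, one_smul]
    rw [Measure.dirac_apply_of_mem (by simp)]
    exact ENNReal.div_le_of_le_mul (by norm_num)

end Testing

/-! ### A set attaining the total variation distance -/

section Density

variable {χ : Type*} [MeasurableSpace χ]

lemma integrable_of_isProbabilityMeasure_withDensity {P : Measure χ} {g : χ → ℝ}
    (hg : Measurable g) (hg0 : ∀ x, 0 ≤ g x)
    (hQ : IsProbabilityMeasure (P.withDensity fun x => ENNReal.ofReal (g x))) :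
    Integrable g P ∧ ∫ x, g x ∂P = 1 := by
  have h1 := hQ.measure_univ
  rw [withDensity_apply _ MeasurableSet.univ, Measure.restrict_univ] at h1
  have hgi : Integrable g P := by
    refine ⟨hg.aestronglyMeasurable, ?_⟩
    rw [hasFiniteIntegral_iff_ofReal (Filter.Eventually.of_forall hg0), h1]
    exact ENNReal.one_lt_top
  refine ⟨hgi, ?_⟩
  rw [integral_eq_lintegral_of_nonneg_ae (Filter.Eventually.of_forall hg0) hgi.1, h1]
  simp

/-- The likelihood-ratio region `{g < 1}` is where `max (1 - g) 0` lives. -/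
lemma exists_measurableSet_measureReal_sub_eq_tvDist (P : Measure χ) [IsProbabilityMeasure P]
    {g : χ → ℝ} (hg : Measurable g) (hg0 : ∀ x, 0 ≤ g x)
    (hQ : IsProbabilityMeasure (P.withDensity fun x => ENNReal.ofReal (g x))) :
    ∃ S, MeasurableSet S ∧ P.real S - (P.withDensity fun x => ENNReal.ofReal (g x)).real S =
      tvDist P (P.withDensity fun x => ENNReal.ofReal (g x)) := by
  obtain ⟨hgi, hg1⟩ := integrable_of_isProbabilityMeasure_withDensity hg hg0 hQ
  have hS : MeasurableSet {x | g x < 1} := measurableSet_lt hg measurable_const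
  refine ⟨{x | g x < 1}, hS, ?_⟩
  have e1 : (P.withDensity fun x => ENNReal.ofReal (g x)).real {x | g x < 1} =
      ∫ x in {x | g x < 1}, g x ∂P := by
    rw [measureReal_def, withDensity_apply _ hS, integral_eq_lintegral_of_nonneg_ae
      (Filter.Eventually.of_forall hg0) hgi.1.restrict]
  have e2 : P.real {x | g x < 1} = ∫ x in {x | g x < 1}, (1 : ℝ) ∂P := by simp
  rw [tvDist_withDensity P hg hg0 hgi hg1, e1, e2,
    ← integral_sub (integrable_const _) hgi.integrableOn, ← integral_indicator hS]
  congr 1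
  funext x
  by_cases h : g x < 1
  · rw [Set.indicator_of_mem (by exact h), max_eq_left (by linarith)]
  · rw [Set.indicator_of_notMem (by exact h), max_eq_right (by linarith)]

end Density

/-! ### Moment bounds for exponentially tilted densities -/

section Moments

variable {χ : Type*} [MeasurableSpace χ] {P : Measure χ} {Y : χ → ℝ}

/-- Instead of Hölder, `|y|` is bounded below by a combination of `y²` and `y⁴` that touches it at
`|y| = √(V ζ)`, the choice that is optimal after integration. With `|y| = √(V ζ) w` the inequality
is `w (w - 1)² (w + 2) ≥ 0`. -/
lemma sqrt_div_sqrt_le_integral_abs {ζ V : ℝ} (hζ : 0 < ζ) (hV : 0 < V)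
    (hY1 : Integrable Y P) (hY2 : Integrable (fun x => Y x ^ 2) P)
    (hY4 : Integrable (fun x => Y x ^ 4) P) (h2 : ∫ x, Y x ^ 2 ∂P = V)
    (h4 : ∫ x, Y x ^ 4 ∂P ≤ ζ * V ^ 2) :
    Real.sqrt V / Real.sqrt ζ ≤ ∫ x, |Y x| ∂P := by
  set s := Real.sqrt V with hs
  set z := Real.sqrt ζ with hz
  have hs0 : 0 < s := Real.sqrt_pos.2 hV
  have hz0 : 0 < z := Real.sqrt_pos.2 hζ
  have hsV : V = s ^ 2 := (Real.sq_sqrt hV.le).symm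
  have hzζ : ζ = z ^ 2 := (Real.sq_sqrt hζ.le).symm
  have hpt : ∀ y : ℝ, 3 / (2 * (s * z)) * y ^ 2 - 1 / (2 * (s * z) ^ 3) * y ^ 4 ≤ |y| := fun y => by
    obtain ⟨w, hw⟩ : ∃ w, |y| = (s * z) * w :=
      ⟨|y| / (s * z), by field_simp⟩
    have hw0 : 0 ≤ w := by
      by_contra hneg
      have : (s * z) * w < 0 := mul_neg_of_pos_of_neg (by positivity) (not_le.1 hneg)
      linarith [abs_nonneg y]
    have e2 : y ^ 2 = ((s * z) * w) ^ 2 := by rw [← hw, sq_abs]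
    have e4 : y ^ 4 = ((s * z) * w) ^ 4 := by
      rw [show y ^ 4 = (y ^ 2) ^ 2 by ring, e2]; ring
    rw [hw, e2, e4]
    have e : 3 / (2 * (s * z)) * (s * z * w) ^ 2 - 1 / (2 * (s * z) ^ 3) * (s * z * w) ^ 4 =
        s * z * (w * (3 * w - w ^ 3) / 2) := by field_simp
    rw [e]
    have : w * (3 * w - w ^ 3) / 2 ≤ w := by
      nlinarith [mul_nonneg hw0 (mul_nonneg (sq_nonneg (w - 1)) (by linarith : 0 ≤ w + 2))]
    gcongr
  calc s / z = 3 / (2 * (s * z)) * V - 1 / (2 * (s * z) ^ 3) * (ζ * V ^ 2) := by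
        rw [hsV, hzζ]; field_simp; norm_num
    _ ≤ 3 / (2 * (s * z)) * V - 1 / (2 * (s * z) ^ 3) * ∫ x, Y x ^ 4 ∂P := by gcongr
    _ = ∫ x, (3 / (2 * (s * z)) * Y x ^ 2 - 1 / (2 * (s * z) ^ 3) * Y x ^ 4) ∂P := by
        rw [integral_sub (hY2.const_mul _) (hY4.const_mul _), integral_const_mul,
          integral_const_mul, h2]
    _ ≤ _ := integral_mono ((hY2.const_mul _).sub (hY4.const_mul _)) hY1.abs fun x => hpt _

/-- For `y ≥ 0` the left side is nonpositive. For `y ≤ 0`, `e^(y - ψ) ≤ e^(c y)`, so the exponent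
may be shrunk before the quadratic expansion; this keeps the bound useful for large `y`. -/
lemma half_abs_sub_le_max_one_sub_exp {c y ψ : ℝ} (hc0 : 0 ≤ c) (hc1 : c ≤ 1) (hψ : 0 ≤ ψ) :
    c / 2 * |y| - c / 2 * y - c ^ 2 / 2 * y ^ 2 ≤ max (1 - Real.exp (y - ψ)) 0 := by
  rcases le_total 0 y with hy | hy
  · rw [abs_of_nonneg hy]
    refine le_max_of_le_right ?_
    have : 0 ≤ c ^ 2 / 2 * y ^ 2 := by positivity
    linarith
  · rw [abs_of_nonpos hy]
    refine le_max_of_le_left ?_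
    have hcy : 0 ≤ -(c * y) := by nlinarith
    have h1 : Real.exp (y - ψ) ≤ Real.exp (c * y) := Real.exp_le_exp.2 (by nlinarith)
    have h2 : Real.exp (c * y) ≤ 1 + c * y + (c * y) ^ 2 / 2 := by
      have := Real.quadratic_le_exp_of_nonneg hcy
      have hp := Real.exp_pos (c * y)
      have hmul : Real.exp (-(c * y)) * Real.exp (c * y) = 1 := by rw [← Real.exp_add]; simp
      set t := -(c * y) with ht
      have hct : c * y = -t := by rw [ht]; ring
      rw [hct] at hp hmul ⊢
      -- The product is `1 + t⁴ / 4`, which turns the lower bound on `e^t` into an upper bound on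
      -- `e^(-t)`.
      have h3 : 1 ≤ (1 + t + t ^ 2 / 2) * (1 - t + t ^ 2 / 2) := by
        nlinarith [sq_nonneg (t ^ 2)]
      have h4 : (1 + t + t ^ 2 / 2) * Real.exp (-t) ≤ 1 := by
        calc _ ≤ Real.exp t * Real.exp (-t) := by gcongr
          _ = 1 := hmul
      have h5 : 0 < 1 + t + t ^ 2 / 2 := by positivity
      have h6 := le_of_mul_le_mul_left (h4.trans h3) h5
      nlinarith
    nlinarith

lemma nonneg_of_integral_exp_sub_eq_one [IsProbabilityMeasure P] {h ψ : ℝ} (hY1 : Integrable Y P) (h1 : ∫ x, Y x ∂P = 0)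
    (hgi : Integrable (fun x => Real.exp (h * Y x - ψ)) P)
    (hg1 : ∫ x, Real.exp (h * Y x - ψ) ∂P = 1) : 0 ≤ ψ := by
  have hi : Integrable (fun x => h * Y x) P := hY1.const_mul h
  have : ∫ x, (h * Y x - (ψ - 1)) ∂P ≤ 1 := by
    rw [← hg1]
    exact integral_mono (hi.sub (integrable_const _)) hgi fun x => by
      linarith [Real.add_one_le_exp (h * Y x - ψ)]
  rw [integral_sub hi (integrable_const _), integral_const_mul, h1] at this
  simp only [integral_const, probReal_univ, smul_eq_mul] at this
  linarith

/-- The pointwise bound is integrated with `c = v / (|h| √V)`. The free `v` matters because at `v =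
|h| √V` the bound becomes negative for large `h`. -/
lemma le_integral_max_one_sub_exp [IsProbabilityMeasure P] {ζ V h ψ v : ℝ} (hζ : 0 < ζ) (hV : 0 < V)
    (hY1 : Integrable Y P) (hY2 : Integrable (fun x => Y x ^ 2) P)
    (hY4 : Integrable (fun x => Y x ^ 4) P) (h1 : ∫ x, Y x ∂P = 0) (h2 : ∫ x, Y x ^ 2 ∂P = V)
    (h4 : ∫ x, Y x ^ 4 ∂P ≤ ζ * V ^ 2)
    (hgi : Integrable (fun x => Real.exp (h * Y x - ψ)) P)
    (hg1 : ∫ x, Real.exp (h * Y x - ψ) ∂P = 1) (hv0 : 0 ≤ v) (hv : v ≤ |h| * Real.sqrt V) :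
    v / (2 * Real.sqrt ζ) - v ^ 2 / 2 ≤ ∫ x, max (1 - Real.exp (h * Y x - ψ)) 0 ∂P := by
  have hψ := nonneg_of_integral_exp_sub_eq_one hY1 h1 hgi hg1
  have hs0 : 0 < Real.sqrt V := Real.sqrt_pos.2 hV
  have hz0 : 0 < Real.sqrt ζ := Real.sqrt_pos.2 hζ
  have hmi : Integrable (fun x => max (1 - Real.exp (h * Y x - ψ)) 0) P :=
    ((integrable_const _).sub hgi).pos_part
  rcases hv0.eq_or_lt with rfl | hvpos
  · simpa using integral_nonneg fun x => le_max_right (1 - Real.exp (h * Y x - ψ)) 0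
  have hu0 : 0 < |h| * Real.sqrt V := hvpos.trans_le hv
  have hh0 : 0 < |h| := pos_of_mul_pos_left hu0 hs0.le
  set c := v / (|h| * Real.sqrt V) with hc
  have hc0 : 0 ≤ c := by positivity
  have hc1 : c ≤ 1 := (div_le_one hu0).2 hv
  have hYa : Integrable (fun x => |h * Y x|) P := (hY1.const_mul h).abs
  have hYq : Integrable (fun x => (h * Y x) ^ 2) P := by
    simpa [mul_pow] using hY2.const_mul (h ^ 2)
  have hYl : Integrable (fun x => h * Y x) P := hY1.const_mul h
  have habs := sqrt_div_sqrt_le_integral_abs hζ hV hY1 hY2 hY4 h2 h4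
  calc v / (2 * Real.sqrt ζ) - v ^ 2 / 2
      = c / 2 * (|h| * (Real.sqrt V / Real.sqrt ζ)) - c / 2 * (h * 0) - c ^ 2 / 2 * (h ^ 2 * V) := by
        have e : h ^ 2 * V = (|h| * Real.sqrt V) ^ 2 := by
          rw [mul_pow, sq_abs, Real.sq_sqrt hV.le]
        have e' : c * (|h| * Real.sqrt V) = v := div_mul_cancel₀ _ hu0.ne'
        rw [e]
        nth_rewrite 1 2 [← e']
        field_simp
        ring
    _ ≤ c / 2 * (|h| * ∫ x, |Y x| ∂P) - c / 2 * (h * 0) - c ^ 2 / 2 * (h ^ 2 * V) := by gcongr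
    _ = ∫ x, (c / 2 * |h * Y x| - c / 2 * (h * Y x) - c ^ 2 / 2 * (h * Y x) ^ 2) ∂P := by
        have e : ∫ x, (c / 2 * |h * Y x| - c / 2 * (h * Y x)) - c ^ 2 / 2 * (h * Y x) ^ 2 ∂P =
            ∫ x, c / 2 * |h * Y x| - c / 2 * (h * Y x) ∂P - ∫ x, c ^ 2 / 2 * (h * Y x) ^ 2 ∂P :=
          integral_sub ((hYa.const_mul _).sub (hYl.const_mul _)) (hYq.const_mul _)
        rw [e, integral_sub (hYa.const_mul _) (hYl.const_mul _)]
        simp only [integral_const_mul, abs_mul, mul_pow, h1, h2]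
    _ ≤ _ := integral_mono (((hYa.const_mul _).sub (hYl.const_mul _)).sub (hYq.const_mul _)) hmi
        fun x => half_abs_sub_le_max_one_sub_exp hc0 hc1 hψ

/-- Here `1 - e^(y - ψ) ≤ ψ - y`, and the AM-GM bound on `|Y|` by `Y²` has mean `√V`. -/
lemma integral_max_one_sub_exp_le [IsProbabilityMeasure P] {V h ψ : ℝ} (hV : 0 < V)
    (hY1 : Integrable Y P) (hY2 : Integrable (fun x => Y x ^ 2) P)
    (h1 : ∫ x, Y x ∂P = 0) (h2 : ∫ x, Y x ^ 2 ∂P = V)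
    (hgi : Integrable (fun x => Real.exp (h * Y x - ψ)) P)
    (hg1 : ∫ x, Real.exp (h * Y x - ψ) ∂P = 1) :
    ∫ x, max (1 - Real.exp (h * Y x - ψ)) 0 ∂P ≤ ψ + |h| * Real.sqrt V := by
  have hψ := nonneg_of_integral_exp_sub_eq_one hY1 h1 hgi hg1
  have hs0 : 0 < Real.sqrt V := Real.sqrt_pos.2 hV
  have habs : ∀ y : ℝ, |y| ≤ 1 / (2 * Real.sqrt V) * y ^ 2 + Real.sqrt V / 2 := fun y => by
    have e : 1 / (2 * Real.sqrt V) * y ^ 2 + Real.sqrt V / 2 - |y| =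
        (|y| - Real.sqrt V) ^ 2 / (2 * Real.sqrt V) := by
      rw [← sq_abs y]; field_simp; ring
    have : 0 ≤ (|y| - Real.sqrt V) ^ 2 / (2 * Real.sqrt V) := by positivity
    linarith
  have hi : Integrable (fun x => |h| * (1 / (2 * Real.sqrt V) * Y x ^ 2 + Real.sqrt V / 2)) P :=
    ((hY2.const_mul _).add (integrable_const _)).const_mul _
  calc ∫ x, max (1 - Real.exp (h * Y x - ψ)) 0 ∂P
      ≤ ∫ x, (ψ + |h| * (1 / (2 * Real.sqrt V) * Y x ^ 2 + Real.sqrt V / 2)) ∂P := by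
        refine integral_mono ((integrable_const _).sub hgi).pos_part
          ((integrable_const _).add hi) fun x => max_le ?_ ?_
        · have e1 := Real.add_one_le_exp (h * Y x - ψ)
          have e2 : -(h * Y x) ≤ |h| * |Y x| := by rw [← abs_mul]; exact neg_le_abs _
          have e3 := mul_le_mul_of_nonneg_left (habs (Y x)) (abs_nonneg h)
          linarith
        · positivity
    _ = ψ + |h| * (1 / (2 * Real.sqrt V) * V + Real.sqrt V / 2) := by
        rw [integral_add (integrable_const _) hi, integral_const_mul,
          integral_add (hY2.const_mul _) (integrable_const _), integral_const_mul, h2]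
        simp
    _ = _ := by
        have : 1 / (2 * Real.sqrt V) * V = Real.sqrt V / 2 := by
          nth_rewrite 2 [← Real.sq_sqrt hV.le]
          field_simp
        rw [this]; ring

end Moments

/-! ### Total variation against parameter distance in the family -/

section ExponentialFamily

variable {μ : Measure ℝ} {θ θ₀ θ₁ : ℝ}

lemma expMeasure_eq_tilted [NeZero μ] (hθ : θ ∈ paramSpace μ) :
    expMeasure μ θ = μ.tilted (θ * ·) := by
  unfold expMeasure Measure.tilted
  congr 1
  funext x
  have : Real.exp (logNorm μ θ) = ∫ x, Real.exp (θ * x) ∂μ :=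
    exp_cgf (X := id) hθ
  rw [Real.exp_sub, this]

lemma isProbabilityMeasure_expMeasure [NeZero μ] (hθ : θ ∈ paramSpace μ) :
    IsProbabilityMeasure (expMeasure μ θ) := by
  rw [expMeasure_eq_tilted hθ]
  exact isProbabilityMeasure_tilted hθ

/-- The centre `m` cancels; taking it to be the mean `A'(θ₀)` gives the form `h Y - ψ` with `Y`
centred. -/
lemma expMeasure_eq_withDensity (μ : Measure ℝ) (θ₀ θ₁ m : ℝ) :
    expMeasure μ θ₁ = (expMeasure μ θ₀).withDensity fun x => ENNReal.ofReal
      (Real.exp ((θ₁ - θ₀) * (x - m) - (logNorm μ θ₁ - logNorm μ θ₀ - (θ₁ - θ₀) * m))) := by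
  unfold expMeasure
  rw [← withDensity_mul _ (by fun_prop) (by fun_prop)]
  congr 1
  funext x
  rw [Pi.mul_apply, ← ENNReal.ofReal_mul (Real.exp_pos _).le, ← Real.exp_add]
  congr 2
  ring

lemma integrable_expMeasure_density [NeZero μ] (hθ₁ : θ₁ ∈ paramSpace μ) (m : ℝ) :
    Integrable (fun x => Real.exp ((θ₁ - θ₀) * (x - m) -
      (logNorm μ θ₁ - logNorm μ θ₀ - (θ₁ - θ₀) * m))) (expMeasure μ θ₀) ∧
    ∫ x, Real.exp ((θ₁ - θ₀) * (x - m) -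
      (logNorm μ θ₁ - logNorm μ θ₀ - (θ₁ - θ₀) * m)) ∂(expMeasure μ θ₀) = 1 := by
  refine integrable_of_isProbabilityMeasure_withDensity (by fun_prop)
    (fun _ => (Real.exp_pos _).le) ?_
  rw [← expMeasure_eq_withDensity]
  exact isProbabilityMeasure_expMeasure hθ₁

lemma tvDist_expMeasure [NeZero μ] (hθ₀ : θ₀ ∈ paramSpace μ) (hθ₁ : θ₁ ∈ paramSpace μ) (m : ℝ) :
    tvDist (expMeasure μ θ₀) (expMeasure μ θ₁) = ∫ x, max (1 - Real.exp ((θ₁ - θ₀) * (x - m) -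
      (logNorm μ θ₁ - logNorm μ θ₀ - (θ₁ - θ₀) * m))) 0 ∂(expMeasure μ θ₀) := by
  have := isProbabilityMeasure_expMeasure hθ₀
  obtain ⟨h1, h2⟩ := integrable_expMeasure_density (θ₀ := θ₀) hθ₁ m
  rw [expMeasure_eq_withDensity μ θ₀ θ₁ m]
  exact tvDist_withDensity _ (by fun_prop) (fun _ => (Real.exp_pos _).le) h1 h2

lemma exists_measurableSet_expMeasure_sub_eq_tvDist [NeZero μ] (hθ₀ : θ₀ ∈ paramSpace μ)
    (hθ₁ : θ₁ ∈ paramSpace μ) : ∃ S, MeasurableSet S ∧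
      (expMeasure μ θ₀).real S - (expMeasure μ θ₁).real S =
        tvDist (expMeasure μ θ₀) (expMeasure μ θ₁) := by
  have := isProbabilityMeasure_expMeasure hθ₀
  have h1 := isProbabilityMeasure_expMeasure hθ₁
  rw [expMeasure_eq_withDensity μ θ₀ θ₁ 0] at h1 ⊢
  exact exists_measurableSet_measureReal_sub_eq_tvDist _ (by fun_prop)
    (fun _ => (Real.exp_pos _).le) h1

lemma uIcc_subset_paramSpace (hθ₀ : θ₀ ∈ paramSpace μ) (hθ₁ : θ₁ ∈ paramSpace μ) :
    Set.uIcc θ₀ θ₁ ⊆ paramSpace μ := by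
  rw [← segment_eq_uIcc]
  exact (convex_integrableExpSet (X := id)).segment_subset hθ₀ hθ₁

/-- The endpoints may lie on the boundary of the parameter space, beyond the reach of analyticity.
The two endpoint exponentials dominate all those between. -/
lemma continuousOn_logNorm [NeZero μ] (hθ₀ : θ₀ ∈ paramSpace μ) (hθ₁ : θ₁ ∈ paramSpace μ) :
    ContinuousOn (logNorm μ) (Set.uIcc θ₀ θ₁) := by
  refine ContinuousOn.log ?_ fun θ hθ =>
    (mgf_pos' (X := id) (NeZero.ne μ) (uIcc_subset_paramSpace hθ₀ hθ₁ hθ)).ne'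
  refine continuousOn_of_dominated (bound := fun x => Real.exp (θ₀ * x) + Real.exp (θ₁ * x))
    (fun θ _ => Measurable.aestronglyMeasurable (by fun_prop)) (fun θ hθ =>
      Filter.Eventually.of_forall fun x => ?_) (Integrable.add hθ₀ hθ₁)
    (Filter.Eventually.of_forall fun x => by fun_prop)
  rw [Real.norm_eq_abs, abs_of_pos (Real.exp_pos _)]
  have hle : θ * x ≤ max (θ₀ * x) (θ₁ * x) := by
    rcases Set.mem_uIcc.1 hθ with h | h <;> rcases le_total 0 x with hx | hx
    · exact le_max_of_le_right (mul_le_mul_of_nonneg_right h.2 hx)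
    · exact le_max_of_le_left (mul_le_mul_of_nonpos_right h.1 hx)
    · exact le_max_of_le_left (mul_le_mul_of_nonneg_right h.2 hx)
    · exact le_max_of_le_right (mul_le_mul_of_nonpos_right h.1 hx)
  rcases le_max_iff.1 hle with h | h
  · linarith [Real.exp_le_exp.2 h, Real.exp_pos (θ₁ * x)]
  · linarith [Real.exp_le_exp.2 h, Real.exp_pos (θ₀ * x)]

lemma continuousOn_tvDist_expMeasure [NeZero μ] (hθ₀ : θ₀ ∈ paramSpace μ)
    (hθ₁ : θ₁ ∈ paramSpace μ) :
    ContinuousOn (fun θ => tvDist (expMeasure μ θ₀) (expMeasure μ θ)) (Set.uIcc θ₀ θ₁) := by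
  have := isProbabilityMeasure_expMeasure hθ₀
  have hA := continuousOn_logNorm hθ₀ hθ₁
  refine ContinuousOn.congr ?_ fun θ hθ =>
    tvDist_expMeasure hθ₀ (uIcc_subset_paramSpace hθ₀ hθ₁ hθ) 0
  refine continuousOn_of_dominated (bound := fun _ => (1 : ℝ))
    (fun θ _ => Measurable.aestronglyMeasurable (by fun_prop)) (fun θ hθ =>
      Filter.Eventually.of_forall fun x => ?_) (integrable_const _)
    (Filter.Eventually.of_forall fun x => by fun_prop)
  rw [Real.norm_eq_abs, abs_of_nonneg (le_max_right _ _)]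
  exact max_le (by linarith [Real.exp_pos ((θ - θ₀) * (x - 0) -
    (logNorm μ θ - logNorm μ θ₀ - (θ - θ₀) * 0))]) zero_le_one

lemma tvDist_expMeasure_le_one [NeZero μ] (hθ₀ : θ₀ ∈ paramSpace μ) (hθ₁ : θ₁ ∈ paramSpace μ) :
    tvDist (expMeasure μ θ₀) (expMeasure μ θ₁) ≤ 1 := by
  have := isProbabilityMeasure_expMeasure hθ₀
  have := isProbabilityMeasure_expMeasure hθ₁
  obtain ⟨S, -, h⟩ := exists_measurableSet_expMeasure_sub_eq_tvDist hθ₀ hθ₁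
  rw [← h]
  have h1 : (expMeasure μ θ₀).real S ≤ 1 := measureReal_le_one
  have h2 : 0 ≤ (expMeasure μ θ₁).real S := measureReal_nonneg
  linarith

lemma logNorm''_eq (μ : Measure ℝ) (θ : ℝ) :
    logNorm'' μ θ = iteratedDeriv 2 (cgf id μ) θ := by
  rw [iteratedDeriv_succ, iteratedDeriv_one]
  rfl

lemma memLp_expMeasure [NeZero μ] (hθ : θ ∈ interior (paramSpace μ)) (m : ℝ) (p : ℝ≥0) :
    MemLp (fun x : ℝ => x - m) p (expMeasure μ θ) := by
  have := isProbabilityMeasure_expMeasure (interior_subset hθ)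
  have h : MemLp id p (expMeasure μ θ) := by
    rw [expMeasure_eq_tilted (interior_subset hθ)]
    exact memLp_tilted_mul (X := id) hθ p
  exact h.sub (memLp_const m)

lemma integrable_sub_pow_expMeasure [NeZero μ] (hθ : θ ∈ interior (paramSpace μ)) (m : ℝ) (n : ℕ) :
    Integrable (fun x : ℝ => (x - m) ^ n) (expMeasure μ θ) := by
  have := isProbabilityMeasure_expMeasure (interior_subset hθ)
  have h := (memLp_expMeasure hθ m n).integrable_norm_pow'
  refine h.mono' (Measurable.aestronglyMeasurable (by fun_prop))
    (Filter.Eventually.of_forall fun x => by simp)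

lemma integral_sub_expMeasure [NeZero μ] (hθ : θ ∈ interior (paramSpace μ)) :
    ∫ x, (x - logNorm' μ θ) ∂(expMeasure μ θ) = 0 := by
  have := isProbabilityMeasure_expMeasure (interior_subset hθ)
  have hi : Integrable (fun x : ℝ => x) (expMeasure μ θ) := by
    simpa using integrable_sub_pow_expMeasure hθ 0 1
  have he : ∫ x, x ∂(expMeasure μ θ) = logNorm' μ θ := by
    rw [expMeasure_eq_tilted (interior_subset hθ)]
    exact integral_tilted_mul_self (X := id) hθ
  rw [integral_sub hi (integrable_const _), he]
  simp

lemma integral_sub_sq_expMeasure [NeZero μ] (hθ : θ ∈ interior (paramSpace μ)) :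
    ∫ x, (x - logNorm' μ θ) ^ 2 ∂(expMeasure μ θ) = logNorm'' μ θ := by
  have he : (expMeasure μ θ)[id] = logNorm' μ θ := by
    rw [expMeasure_eq_tilted (interior_subset hθ)]
    exact integral_tilted_mul_self (X := id) hθ
  rw [logNorm''_eq, ← variance_tilted_mul (X := id) hθ]
  have h := expMeasure_eq_tilted (interior_subset hθ)
  change _ = Var[id; μ.tilted (θ * ·)]
  rw [← h, variance_eq_integral aemeasurable_id, he]
  rfl

lemma logNorm''_nonneg [NeZero μ] (hθ : θ ∈ interior (paramSpace μ)) : 0 ≤ logNorm'' μ θ := by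
  rw [← integral_sub_sq_expMeasure hθ]
  exact integral_nonneg fun _ => sq_nonneg _

/-- Let `u = |θ₁ - θ₀| √V`. If `u ≥ 1 / (2√ζ)`, taking `v = 1 / (2√ζ)` gives distance at least `1 /
(8ζ) = 16 / (128ζ)`, against `htv`. Otherwise `v = u` works, as the quadratic loss is at most half
the linear term. No smoothness of `A''` is needed, so `θ₁` may be any parameter. -/
lemma abs_sub_mul_sqrt_le_tvDist [NeZero μ] {ζ : ℝ} (hζ : 0 < ζ)
    (hθ₀ : θ₀ ∈ interior (paramSpace μ)) (hθ₁ : θ₁ ∈ paramSpace μ) (hV : 0 < logNorm'' μ θ₀)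
    (h4 : (∫ x, (x - logNorm' μ θ₀) ^ 4 ∂(expMeasure μ θ₀)) / (logNorm'' μ θ₀) ^ 2 ≤ ζ)
    (htv : tvDist (expMeasure μ θ₀) (expMeasure μ θ₁) ≤ 9 / (128 * ζ)) :
    |θ₁ - θ₀| * Real.sqrt (logNorm'' μ θ₀) ≤
      4 * Real.sqrt ζ * tvDist (expMeasure μ θ₀) (expMeasure μ θ₁) := by
  have := isProbabilityMeasure_expMeasure (interior_subset hθ₀)
  obtain ⟨hgi, hg1⟩ := integrable_expMeasure_density (θ₀ := θ₀) hθ₁ (logNorm' μ θ₀)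
  have hlow := fun v => le_integral_max_one_sub_exp (v := v) hζ hV
    (by simpa using integrable_sub_pow_expMeasure hθ₀ (logNorm' μ θ₀) 1)
    (integrable_sub_pow_expMeasure hθ₀ _ 2) (integrable_sub_pow_expMeasure hθ₀ _ 4)
    (integral_sub_expMeasure hθ₀) (integral_sub_sq_expMeasure hθ₀)
    ((div_le_iff₀ (by positivity)).1 h4) hgi hg1
  rw [← tvDist_expMeasure (interior_subset hθ₀) hθ₁] at hlow
  set T := tvDist (expMeasure μ θ₀) (expMeasure μ θ₁)
  set u := |θ₁ - θ₀| * Real.sqrt (logNorm'' μ θ₀) with hu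
  have hu0 : 0 ≤ u := by positivity
  set z := Real.sqrt ζ with hz
  have hz0 : 0 < z := Real.sqrt_pos.2 hζ
  have hzζ : ζ = z ^ 2 := (Real.sq_sqrt hζ.le).symm
  rcases le_total (1 / (2 * z)) u with h | h
  · have h1 := hlow (1 / (2 * z)) (by positivity) h
    have h2 : 1 / (2 * z) / (2 * z) - (1 / (2 * z)) ^ 2 / 2 = 16 / (128 * ζ) := by
      rw [hzζ]; field_simp; norm_num
    have h3 : 9 / (128 * ζ) < 16 / (128 * ζ) := by gcongr; norm_num
    linarith
  · have h1 := hlow u hu0 le_rfl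
    have h2 : u ^ 2 / 2 ≤ u / (4 * z) := by
      calc u ^ 2 / 2 = u * u / 2 := by ring
        _ ≤ u * (1 / (2 * z)) / 2 := by gcongr
        _ = _ := by field_simp; norm_num
    have h3 : u / (2 * z) = u / (4 * z) + u / (4 * z) := by field_simp; ring
    have h4 : u / (4 * z) ≤ T := by linarith
    rw [div_le_iff₀ (by positivity)] at h4
    linarith

/-- Identifiability is the previous bound at distance zero; `ζ` can be the fourth-moment ratio
itself, raised to `1` to be positive. -/
lemma eq_of_expMeasure_eq [NeZero μ] (hθ₀ : θ₀ ∈ interior (paramSpace μ))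
    (hθ₁ : θ₁ ∈ paramSpace μ) (hV : 0 < logNorm'' μ θ₀)
    (h : expMeasure μ θ₁ = expMeasure μ θ₀) : θ₁ = θ₀ := by
  have key := abs_sub_mul_sqrt_le_tvDist (lt_max_of_lt_right zero_lt_one) hθ₀ hθ₁ hV
    (le_max_left _ (1 : ℝ)) (by rw [h, tvDist_self]; positivity)
  rw [h, tvDist_self, mul_zero] at key
  have hs := Real.sqrt_pos.2 hV
  have : |θ₁ - θ₀| ≤ 0 := nonpos_of_mul_nonpos_left key hs
  exact sub_eq_zero.1 (abs_nonpos_iff.1 this)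

lemma natParam_expMeasure [NeZero μ] (hθ : θ ∈ interior (paramSpace μ))
    (hV : 0 < logNorm'' μ θ) : natParam μ (expMeasure μ θ) = θ := by
  have hex : ∃ a ∈ paramSpace μ, expMeasure μ a = expMeasure μ θ := ⟨θ, interior_subset hθ, rfl⟩
  exact eq_of_expMeasure_eq hθ (Function.invFunOn_mem hex) hV (Function.invFunOn_eq hex)

lemma logNorm_sub_sub_le [NeZero μ]
    (hΦ : Set.uIcc θ₀ θ₁ ⊆ interior (paramSpace μ))
    {B : ℝ} (hB : ∀ θ ∈ Set.uIcc θ₀ θ₁, logNorm'' μ θ ≤ 2 * B) :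
    logNorm μ θ₁ - logNorm μ θ₀ - (θ₁ - θ₀) * logNorm' μ θ₀ ≤ (θ₁ - θ₀) ^ 2 * B := by
  rcases eq_or_ne θ₀ θ₁ with rfl | hne
  · simp
  have han : AnalyticOnNhd ℝ (logNorm μ) (interior (paramSpace μ)) :=
    analyticOnNhd_cgf (X := id) (μ := μ)
  have hcd : ContDiffOn ℝ (1 + 1) (logNorm μ) (Set.uIcc θ₀ θ₁) :=
    (han.mono hΦ).analyticOn.contDiffOn (uniqueDiffOn_uIcc hne)
  obtain ⟨x', hx', he⟩ := taylor_mean_remainder_lagrange_iteratedDeriv (n := 1) hne hcd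
  have hd : derivWithin (logNorm μ) (Set.uIcc θ₀ θ₁) θ₀ = logNorm' μ θ₀ :=
    (han θ₀ (hΦ Set.left_mem_uIcc)).differentiableAt.derivWithin
      (uniqueDiffOn_uIcc hne θ₀ Set.left_mem_uIcc)
  rw [taylorWithinEval_succ, taylor_within_zero_eval, iteratedDerivWithin_one, hd] at he
  have h2 : iteratedDeriv (1 + 1) (logNorm μ) x' = logNorm'' μ x' := (logNorm''_eq μ x').symm
  rw [h2] at he
  have hx := hB x' (Set.Ioo_subset_Icc_self hx')
  norm_num at he
  nlinarith [sq_nonneg (θ₁ - θ₀)]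

/-- With `u = |θ₁ - θ₀| √V`, the moment bound and Taylor's formula give `u² + u`, which is at most
`2u` for `u ≤ 1`; for larger `u` the trivial bound `1` suffices. -/
lemma tvDist_expMeasure_le [NeZero μ] (hΦ : Set.uIcc θ₀ θ₁ ⊆ interior (paramSpace μ))
    (hV : 0 < logNorm'' μ θ₀)
    (hB : ∀ θ ∈ Set.uIcc θ₀ θ₁, logNorm'' μ θ ≤ 2 * logNorm'' μ θ₀) :
    tvDist (expMeasure μ θ₀) (expMeasure μ θ₁) ≤
      2 * (|θ₁ - θ₀| * Real.sqrt (logNorm'' μ θ₀)) := by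
  have hθ₀ := hΦ Set.left_mem_uIcc
  have hθ₁ : θ₁ ∈ paramSpace μ := interior_subset (hΦ Set.right_mem_uIcc)
  have := isProbabilityMeasure_expMeasure (interior_subset hθ₀)
  have hone := tvDist_expMeasure_le_one (interior_subset hθ₀) hθ₁
  obtain ⟨hgi, hg1⟩ := integrable_expMeasure_density (θ₀ := θ₀) hθ₁ (logNorm' μ θ₀)
  have hup := integral_max_one_sub_exp_le hV
    (by simpa using integrable_sub_pow_expMeasure hθ₀ (logNorm' μ θ₀) 1)
    (integrable_sub_pow_expMeasure hθ₀ _ 2)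
    (integral_sub_expMeasure hθ₀) (integral_sub_sq_expMeasure hθ₀) hgi hg1
  rw [← tvDist_expMeasure (interior_subset hθ₀) hθ₁] at hup
  have hψ := logNorm_sub_sub_le hΦ hB
  have hu : (θ₁ - θ₀) ^ 2 * logNorm'' μ θ₀ = (|θ₁ - θ₀| * Real.sqrt (logNorm'' μ θ₀)) ^ 2 := by
    rw [mul_pow, sq_abs, Real.sq_sqrt hV.le]
  have hu0 : 0 ≤ |θ₁ - θ₀| * Real.sqrt (logNorm'' μ θ₀) := by positivity
  rcases le_total (|θ₁ - θ₀| * Real.sqrt (logNorm'' μ θ₀)) 1 with h | h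
  · nlinarith
  · linarith

end ExponentialFamily

/-! ### Bounds on the local estimation rate -/

section LocalRate

variable {μ : Measure ℝ} {θ₀ : ℝ}

lemma exists_lt_of_lt_smoothRadius {t : ℝ} (h : ENNReal.ofReal t < smoothRadius μ θ₀) :
    ∃ r : ℝ≥0, t < r ∧ ∀ θ' ∈ Set.Icc (θ₀ - r) (θ₀ + r), θ' ∈ interior (paramSpace μ) ∧
      logNorm'' μ θ₀ / logNorm'' μ θ' ∈ Set.Icc (1 / 2 : ℝ) 2 := by
  simp only [smoothRadius, lt_iSup_iff] at h
  obtain ⟨r, hr, hlt⟩ := h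
  refine ⟨r, ?_, hr⟩
  rw [← ENNReal.ofReal_coe_nnreal] at hlt
  exact (ENNReal.ofReal_lt_ofReal_iff'.1 hlt).1

/-- If the total variation modulus at `β` stays within the radius of smoothness, every smaller
distance `β'` is attained inside that radius, where `A''` is comparable with `A''(θ₀)`. -/
lemma exists_param_tvDist_eq [NeZero μ] {θ₁ β β' : ℝ} (hθ₀ : θ₀ ∈ paramSpace μ)
    (hθ₁ : θ₁ ∈ paramSpace μ) (hβ' : 0 ≤ β') (hlt : β' < β)
    (hβ : β ≤ tvDist (expMeasure μ θ₀) (expMeasure μ θ₁))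
    (hκ : tvModulus μ θ₀ β ≤ smoothRadius μ θ₀) :
    ∃ θ, tvDist (expMeasure μ θ₀) (expMeasure μ θ) = β' ∧
      Set.uIcc θ₀ θ ⊆ interior (paramSpace μ) ∧ 0 < logNorm'' μ θ₀ ∧
      ∀ θ' ∈ Set.uIcc θ₀ θ, 0 < logNorm'' μ θ' ∧ logNorm'' μ θ' ≤ 2 * logNorm'' μ θ₀ := by
  have ivt : ∀ {a b : ℝ}, a ∈ paramSpace μ → 0 ≤ b →
      b ≤ tvDist (expMeasure μ θ₀) (expMeasure μ a) →
      ∃ θ ∈ Set.uIcc θ₀ a, tvDist (expMeasure μ θ₀) (expMeasure μ θ) = b := by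
    intro a b ha hb hle
    have := intermediate_value_uIcc (continuousOn_tvDist_expMeasure hθ₀ ha)
    refine this (Set.mem_uIcc_of_le ?_ hle)
    simpa [tvDist_self] using hb
  -- The point `a` at distance exactly `β` is controlled by the modulus. Then `θ` is strictly closer
  -- to `θ₀`, which allows for a supremum in `smoothRadius` that is not attained.
  obtain ⟨a, ha, haβ⟩ := ivt hθ₁ (hβ'.trans hlt.le) hβ
  have haΦ := uIcc_subset_paramSpace hθ₀ hθ₁ ha
  obtain ⟨θ, hθ, hθβ⟩ := ivt haΦ hβ' (by rw [haβ]; exact hlt.le)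
  have hne : θ ≠ a := by
    rintro rfl
    linarith
  have habs : |θ - θ₀| < |a - θ₀| := by
    rcases Set.mem_uIcc.1 hθ with ⟨h1, h2⟩ | ⟨h1, h2⟩
    · have := lt_of_le_of_ne h2 hne
      rw [abs_of_nonneg (by linarith), abs_of_nonneg (by linarith)]
      linarith
    · have := lt_of_le_of_ne h1 hne.symm
      rw [abs_of_nonpos (by linarith), abs_of_nonpos (by linarith)]
      linarith
  have hmod : ENNReal.ofReal |a - θ₀| ≤ tvModulus μ θ₀ β := by
    refine le_iSup₂_of_le (a - θ₀) ?_ le_rfl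
    rw [add_sub_cancel]
    exact ⟨haΦ, haβ.le⟩
  obtain ⟨r, hr, hprop⟩ := exists_lt_of_lt_smoothRadius (μ := μ) (θ₀ := θ₀) (t := |θ - θ₀|)
    ((ENNReal.ofReal_lt_ofReal_iff'.2 ⟨habs, (abs_nonneg _).trans_lt habs⟩).trans_le
      (hmod.trans hκ))
  have hsub : Set.uIcc θ₀ θ ⊆ Set.Icc (θ₀ - r) (θ₀ + r) := by
    obtain ⟨h1, h2⟩ := abs_lt.1 hr
    have hr0 : (0 : ℝ) ≤ r := r.2
    exact Set.uIcc_subset_Icc ⟨by linarith, by linarith⟩ ⟨by linarith, by linarith⟩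
  have hpos : ∀ θ' ∈ Set.uIcc θ₀ θ, 0 < logNorm'' μ θ' := fun θ' hθ' => by
    obtain ⟨hint, hrat, -⟩ := hprop θ' (hsub hθ')
    refine lt_of_le_of_ne (logNorm''_nonneg hint) fun h0 => ?_
    -- Division by zero gives `0`, outside `[1/2, 2]`, so the ratio condition also forces `A'' > 0`.
    rw [← h0, div_zero] at hrat
    norm_num at hrat
  refine ⟨θ, hθβ, fun θ' hθ' => (hprop θ' (hsub hθ')).1, hpos _ Set.left_mem_uIcc,
    fun θ' hθ' => ⟨hpos θ' hθ', ?_⟩⟩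
  have h := (hprop θ' (hsub hθ')).2.1
  rw [le_div_iff₀ (hpos θ' hθ')] at h
  linarith

lemma le_localRate [NeZero μ] {θ β' ε : ℝ} {n : ℕ} (hε : 0 ≤ ε)
    (hθβ : tvDist (expMeasure μ θ₀) (expMeasure μ θ) = β')
    (hsmall : n * (β' * (Real.exp ε - 1)) ≤ 1)
    (hΦ : Set.uIcc θ₀ θ ⊆ interior (paramSpace μ))
    (hV : ∀ θ' ∈ Set.uIcc θ₀ θ, 0 < logNorm'' μ θ' ∧ logNorm'' μ θ' ≤ 2 * logNorm'' μ θ₀) :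
    ENNReal.ofReal (β' / (4 * Real.sqrt (logNorm'' μ θ₀))) ≤
      localRate (expMeasure μ θ₀) (expFamily μ) (dpEstimators ℝ n ε) (natParam μ) := by
  have h0 := hΦ Set.left_mem_uIcc
  have h1 := hΦ Set.right_mem_uIcc
  have hV0 := (hV θ₀ Set.left_mem_uIcc).1
  have := isProbabilityMeasure_expMeasure (interior_subset h0)
  have := isProbabilityMeasure_expMeasure (interior_subset h1)
  refine le_iSup₂_of_le (expMeasure μ θ) ⟨θ, interior_subset h1, rfl⟩ (le_iInf₂ fun M hM => ?_)
  rw [natParam_expMeasure h0 hV0, natParam_expMeasure h1 (hV θ Set.right_mem_uIcc).1]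
  refine le_trans (ENNReal.ofReal_le_ofReal ?_)
    (ofReal_half_abs_sub_le_max_errorRate hε (by rwa [hθβ]) hM)
  have hle := tvDist_expMeasure_le hΦ hV0 fun θ' hθ' => (hV θ' hθ').2
  rw [hθβ] at hle
  have hs := Real.sqrt_pos.2 hV0
  rw [div_le_iff₀ (by positivity)]
  linarith

/-- The distance from `P_θ₀` to `Q` is compared with `β`: below it the constant estimator `θ₀` is
accurate enough, above it the private test makes no error. -/
lemma localRate_le [NeZero μ] {ζ β ε : ℝ} {n : ℕ} (hε : 0 ≤ ε) (hζ : 0 < ζ)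
    (hθ₀ : θ₀ ∈ interior (paramSpace μ)) (hV : 0 < logNorm'' μ θ₀)
    (h4 : (∫ x, (x - logNorm' μ θ₀) ^ 4 ∂(expMeasure μ θ₀)) / (logNorm'' μ θ₀) ^ 2 ≤ ζ)
    (hβ : β ≤ 9 / (128 * ζ))
    (hsep : 2 + n * (ε ^ 2 * Real.exp ε) ≤ n * (ε * (β / 2))) :
    localRate (expMeasure μ θ₀) (expFamily μ) (dpEstimators ℝ n ε) (natParam μ) ≤
      ENNReal.ofReal (4 * Real.sqrt ζ * β / Real.sqrt (logNorm'' μ θ₀)) := by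
  have hP := isProbabilityMeasure_expMeasure (interior_subset hθ₀)
  have hs := Real.sqrt_pos.2 hV
  refine iSup₂_le fun Q hQ => ?_
  have htΦ : natParam μ Q ∈ paramSpace μ := Function.invFunOn_mem hQ
  have htQ : expMeasure μ (natParam μ Q) = Q := Function.invFunOn_eq hQ
  rw [natParam_expMeasure hθ₀ hV]
  set t := natParam μ Q
  rw [← htQ]
  have hQp := isProbabilityMeasure_expMeasure htΦ
  rcases le_total (tvDist (expMeasure μ θ₀) (expMeasure μ t)) β with h | h
  · obtain ⟨M, hM, h1, h2⟩ := exists_dpEstimator_const (P := expMeasure μ θ₀)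
      (Q := expMeasure μ t) n hε θ₀ t
    refine (iInf₂_le M hM).trans ((max_le h1 h2).trans (ENNReal.ofReal_le_ofReal ?_))
    rw [abs_sub_comm, le_div_iff₀ hs]
    refine (abs_sub_mul_sqrt_le_tvDist hζ hθ₀ htΦ hV h4 (h.trans hβ)).trans ?_
    gcongr
  · obtain ⟨S, hS, hST⟩ := exists_measurableSet_expMeasure_sub_eq_tvDist
      (interior_subset hθ₀) htΦ
    obtain ⟨M, hM, h1, h2⟩ := exists_dpEstimator_errorRate_eq_zero (n := n) hS hε
      (hsep.trans (by rw [hST]; gcongr)) θ₀ t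
    refine (iInf₂_le M hM).trans ?_
    rw [h1, h2]
    simp

end LocalRate

end PrivateEstimation

/-! ### Choice of constants and conclusion -/

theorem mainTheorem4 :
    ∀ k ζ : ℝ, 0 < k → 0 < ζ → ∃ C₁ C₂ C₃ : ℝ, 0 < C₁ ∧ 0 < C₂ ∧ 0 < C₃ ∧
      ∀ (μ : Measure ℝ) (θ₀ : ℝ) (ε : ℕ → ℝ) (n : ℕ),
        θ₀ ∈ PrivateEstimation.paramSpace μ →
        1 ≤ n →
        0 < ε n →
        ε n ≤ k / Real.sqrt n →
        (∫ x, (x - PrivateEstimation.logNorm' μ θ₀) ^ 4 ∂(PrivateEstimation.expMeasure μ θ₀)) /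
          (PrivateEstimation.logNorm'' μ θ₀) ^ 2 ≤ ζ →
        PrivateEstimation.tvModulus μ θ₀ (C₃ / (n * ε n)) ≤
          PrivateEstimation.smoothRadius μ θ₀ →
        C₃ / (n * ε n) ≤ 9 / (128 * ζ) →
        (∃ θ₁ ∈ PrivateEstimation.paramSpace μ, C₃ / (n * ε n) ≤
          PrivateEstimation.tvDist (PrivateEstimation.expMeasure μ θ₀)
            (PrivateEstimation.expMeasure μ θ₁)) →
        PrivateEstimation.localRate (PrivateEstimation.expMeasure μ θ₀)
            (PrivateEstimation.expFamily μ) (PrivateEstimation.dpEstimators ℝ n (ε n))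
            (PrivateEstimation.natParam μ) ∈
          Set.Icc
            (ENNReal.ofReal (C₁ / (n * ε n * Real.sqrt (PrivateEstimation.logNorm'' μ θ₀))))
            (ENNReal.ofReal (C₂ / (n * ε n * Real.sqrt (PrivateEstimation.logNorm'' μ θ₀)))) := by
  intro k ζ hk hζ
  -- Chosen so that `C₃ / 2 = 2 + k² e^k`, which covers `2 + n ε² e^ε` in the separation condition
  -- of the test.
  set C₃ := 4 + 2 * k ^ 2 * Real.exp k with hC₃
  have hC₃4 : 4 ≤ C₃ := le_add_of_nonneg_right (by positivity)
  refine ⟨Real.exp (-k) / 4, 4 * Real.sqrt ζ * C₃, C₃, by positivity, by positivity,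
    by positivity, fun μ θ₀ ε n hθ₀ hn hε hεk h4 hκ hβ ⟨θ₁, hθ₁, htv⟩ => ?_⟩
  generalize ε n = e at *
  have hn0 : (1 : ℝ) ≤ n := by exact_mod_cast hn
  have hne : 0 < n * e := by positivity
  -- For `μ = 0` all distances in the family vanish, against `htv`.
  have hμ : NeZero μ := ⟨by
    rintro rfl
    have hz : ∀ θ, PrivateEstimation.expMeasure 0 θ = 0 := fun θ => by
      simp [PrivateEstimation.expMeasure]
    rw [hz, hz, PrivateEstimation.tvDist_self] at htv
    have : 0 < C₃ / (n * e) := by positivity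
    linarith⟩
  have hek : e ≤ k := hεk.trans (div_le_self hk.le (Real.one_le_sqrt.2 hn0))
  have hnek : n * e ^ 2 ≤ k ^ 2 := by
    have hs : 0 < Real.sqrt n := Real.sqrt_pos.2 (by linarith)
    have h := pow_le_pow_left₀ (by positivity) ((le_div_iff₀ hs).1 hεk) 2
    rw [mul_pow, Real.sq_sqrt (by linarith)] at h
    linarith
  have hck : Real.exp (-k) < C₃ := by
    have : Real.exp (-k) ≤ 1 := Real.exp_le_one_iff.2 (by linarith)
    linarith
  -- The factor `e^(-k)` offsets `e^ε - 1 ≤ ε e^k`, so that `n β' (e^ε - 1) ≤ 1`.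
  obtain ⟨θ, hθβ, hΦ, hV, hV'⟩ := PrivateEstimation.exists_param_tvDist_eq
    (β' := Real.exp (-k) / (n * e)) hθ₀ hθ₁ (by positivity) (by gcongr) htv hκ
  refine ⟨?_, ?_⟩
  · refine le_trans (le_of_eq ?_) (PrivateEstimation.le_localRate hε.le hθβ ?_ hΦ hV')
    · congr 1
      have := Real.sqrt_pos.2 hV
      field_simp
    · have h1 : Real.exp e - 1 ≤ e * Real.exp k := by
        have h2 := Real.add_one_le_exp (-e)
        have h3 : Real.exp (-e) * Real.exp e = 1 := by rw [← Real.exp_add]; simp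
        have h4 : Real.exp e ≤ Real.exp k := Real.exp_le_exp.2 hek
        nlinarith [Real.exp_pos e]
      calc n * (Real.exp (-k) / (n * e) * (Real.exp e - 1))
          ≤ n * (Real.exp (-k) / (n * e) * (e * Real.exp k)) := by gcongr
        _ = Real.exp (-k) * Real.exp k := by field_simp
        _ = 1 := by rw [← Real.exp_add]; simp
        _ ≤ 1 := le_rfl
  · refine (PrivateEstimation.localRate_le hε.le hζ (hΦ Set.left_mem_uIcc) hV h4 hβ ?_).trans
      (le_of_eq ?_)
    · have h1 : n * (e * (C₃ / (n * e) / 2)) = C₃ / 2 := by field_simp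
      have h2 : n * (e ^ 2 * Real.exp e) ≤ k ^ 2 * Real.exp k := by
        rw [← mul_assoc]; gcongr
      rw [h1, hC₃]
      linarith
    · congr 1
      have := Real.sqrt_pos.2 hV
      field_simp
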